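/- Let Alice, Bob and Charlie share a finite-dimensional state $\rho=\rho^{ABC}$. A PPT assisted LOCC operation $\Lambda_{\mathrm{PPT}}$ between Bob and Charlie acts as $\Lambda_{\mathrm{PPT}}(\omega)=\mathrm{Tr}_{\tilde B\tilde C}[\Lambda(\omega\otimes\mu^{\tilde B\tilde C})]$, where $\mu^{\tilde B\tilde C}$ is a state with positive partial transpose (on finite-dimensional systems $\tilde B$ of Bob and $\tilde C$ of Charlie of any dimension) and $\Lambda$ is a protocol of local operations and classical communication between Bob's systems and Charlie's systems. Charlie holds in addition a register $R$ of the same dimension as $B$. The fidelity of PPT quantum state merging (PQSM) is $$\mathcal F_{\mathrm{PPT}}(\rho)=\sup_{\Lambda_{\mathrm{PPT}},\,\rho^R}F\bigl(\mathrm{Tr}_B[\Lambda_{\mathrm{PPT}}(\rho^{ABC}\otimes\rho^R)],\,\sigma_t^{ACR}\bigr),\qquad F(\rho,\sigma)=\mathrm{Tr}\bigl[(\sqrt\rho\,\sigma\sqrt\rho)^{1/2}\bigr],$$ where $\rho^R$ is a state of $R$, $\Lambda_{\mathrm{PPT}}$ acts between $B$ and $CR$, and $\sigma_t^{ACR}$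 is $\rho^{ABC}$ with $B$ relabelled as $R$. A state $\rho$ admits perfect asymptotic PQSM if $\mathcal F^\infty_{\mathrm{PPT}}(\rho):=\lim_{n\to\infty}\mathcal F_{\mathrm{PPT}}(\rho^{\otimes n})=1$. The generalized Bloch vector of a two-qubit state $\sigma$ is the vector $(\mathrm{Tr}[\sigma\,(s_j\otimes s_k)])_{(j,k)\ne(0,0)}\in\mathbb R^{15}$, where $s_0$ is the identity and $s_1,s_2,s_3$ are the Pauli matrices. There exist 15 separable two-qubit states $\sigma_0^{BC},\dots,\sigma_{14}^{BC}$ whose generalized Bloch vectors are linearly independent. Moreover, for all such states and all $p_0,\dots,p_{14}>0$ with $\sum_i p_i=1$, the state $$\rho_{\mathrm{sep}}^{ABC}=\sum_{i=0}^{14}p_i\,|i\rangle\langle i|^A\otimes\sigma_i^{BC}$$ (with $\dim A=15$) is fully separable, the limit $\mathcal F^\infty_{\mathrm{PPT}}(\rho_{\mathrm{sep}})$ exists, and $\mathcal F^\infty_{\mathrm{PPT}}(\rho_{\mathrm{sep}})\neq1$; that is, $\rho_{\mathrm{sep}}$ does not admit perfect asymptotic PQSM. -/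

import Mathlib

open Matrix Filter Topology
open scoped Kronecker ComplexOrder MatrixOrder

noncomputable section

/-- Density matrices on the finite-dimensional Hilbert space with orthonormal basis `S`. -/
def IsDensity {S : Type} [Fintype S] (ρ : Matrix S S ℂ) : Prop :=
  ρ.PosSemidef ∧ ρ.trace = 1

/-- Separable bipartite states: convex combinations of product states. -/
def IsSeparableState {B C : Type} [Fintype B] [Fintype C]
    (σ : Matrix (B × C) (B × C) ℂ) : Prop :=
  σ ∈ convexHull ℝ {τ | ∃ (β : Matrix B B ℂ) (γ : Matrix C C ℂ),
    IsDensity β ∧ IsDensity γ ∧ τ = β ⊗ₖ γ}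

/-- Fully separable tripartite states: convex combinations of three-fold product states. -/
def IsFullySeparableState {A B C : Type} [Fintype A] [Fintype B] [Fintype C]
    (ρ : Matrix (A × B × C) (A × B × C) ℂ) : Prop :=
  ρ ∈ convexHull ℝ {τ | ∃ (α : Matrix A A ℂ) (β : Matrix B B ℂ) (γ : Matrix C C ℂ),
    IsDensity α ∧ IsDensity β ∧ IsDensity γ ∧ τ = α ⊗ₖ (β ⊗ₖ γ)}

/-- Partial transposition with respect to the first subsystem. -/
def partialTranspose {B C : Type} (μ : Matrix (B × C) (B × C) ℂ) :
    Matrix (B × C) (B × C) ℂ :=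
  Matrix.of fun x y => μ (y.1, x.2) (x.1, y.2)

/-- Bipartite states with positive partial transpose. -/
def IsPPT {B C : Type} [Fintype B] [Fintype C] (μ : Matrix (B × C) (B × C) ℂ) : Prop :=
  IsDensity μ ∧ (partialTranspose μ).PosSemidef

/-- Fidelity `F(ρ, σ) = Tr (√ρ σ √ρ)^(1/2)` of two states. -/
def fidelity {S : Type} [Fintype S] [DecidableEq S] (ρ σ : Matrix S S ℂ) : ℝ :=
  (CFC.sqrt (CFC.sqrt ρ * σ * CFC.sqrt ρ)).trace.re

/-- LOCC protocols (with finitely many rounds) between Bob and Charlie, as decision trees.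
`LOCC B' C' B C` is the type of protocols that start with Bob's system `B` and Charlie's system `C`
and end with Bob's system `B'` and Charlie's system `C'`. In each step one of the two parties
performs a local quantum measurement, given by Kraus operators `K x` with `∑ x, (K x)ᴴ * K x = 1`,
whose outcome `x` is communicated to the other party; the rest of the protocol may depend on `x`.
Local channels, local unitaries, added ancillas, discarded systems and coarse-grained instruments
are special cases. -/
inductive LOCC (B' C' : Type) [Fintype B'] [DecidableEq B'] [Fintype C'] [DecidableEq C'] :
    (B C : Type) → [Fintype B] → [DecidableEq B] → [Fintype C] → [DecidableEq C] → Type 1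
  | done : LOCC B' C' B' C'
  | bob {B C : Type} [Fintype B] [DecidableEq B] [Fintype C] [DecidableEq C]
      (B₁ : Type) [Fintype B₁] [DecidableEq B₁] (m : ℕ) (K : Fin m → Matrix B₁ B ℂ)
      (hK : ∑ x, (K x)ᴴ * K x = 1) (next : Fin m → LOCC B' C' B₁ C) : LOCC B' C' B C
  | charlie {B C : Type} [Fintype B] [DecidableEq B] [Fintype C] [DecidableEq C]
      (C₁ : Type) [Fintype C₁] [DecidableEq C₁] (m : ℕ) (K : Fin m → Matrix C₁ C ℂ)
      (hK : ∑ x, (K x)ᴴ * K x = 1) (next : Fin m → LOCC B' C' B C₁) : LOCC B' C' B C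

/-- The output of an LOCC protocol between Bob and Charlie on a tripartite input; nothing happens
to Alice's system `A`, and the measurement outcomes are forgotten at the end. -/
def LOCC.run {A B' C' : Type} [Fintype A] [DecidableEq A]
    [Fintype B'] [DecidableEq B'] [Fintype C'] [DecidableEq C'] :
    {B C : Type} → [Fintype B] → [DecidableEq B] → [Fintype C] → [DecidableEq C] →
    LOCC B' C' B C → Matrix (A × B × C) (A × B × C) ℂ → Matrix (A × B' × C') (A × B' × C') ℂ
  | _, _, _, _, _, _, .done, X => X
  | _, _, _, _, _, _, @LOCC.bob _ _ _ _ _ _ _ C _ _ _ _ _ _ _ _ K _ next, X =>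
      ∑ x, (next x).run
        (((1 : Matrix A A ℂ) ⊗ₖ (K x ⊗ₖ (1 : Matrix C C ℂ))) * X *
          ((1 : Matrix A A ℂ) ⊗ₖ (K x ⊗ₖ (1 : Matrix C C ℂ)))ᴴ)
  | _, _, _, _, _, _, @LOCC.charlie _ _ _ _ _ _ B _ _ _ _ _ _ _ _ _ K _ next, X =>
      ∑ x, (next x).run
        (((1 : Matrix A A ℂ) ⊗ₖ ((1 : Matrix B B ℂ) ⊗ₖ K x)) * X *
          ((1 : Matrix A A ℂ) ⊗ₖ ((1 : Matrix B B ℂ) ⊗ₖ K x))ᴴ)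

/-- PPT assisted LOCC protocols between Bob's system `B` and Charlie's system `C`: a PPT state `μ`
of additional systems `Bt` of Bob and `Ct` of Charlie, and an LOCC protocol between
Bob (`B`, `Bt`) and Charlie (`C`, `Ct`). -/
structure PPTAssistedLOCC (B C : Type) [Fintype B] [DecidableEq B] [Fintype C] [DecidableEq C] where
  Bt : Type
  Ct : Type
  [fintypeBt : Fintype Bt]
  [decEqBt : DecidableEq Bt]
  [fintypeCt : Fintype Ct]
  [decEqCt : DecidableEq Ct]
  μ : Matrix (Bt × Ct) (Bt × Ct) ℂ
  isPPT : IsPPT μ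
  protocol : LOCC (B × Bt) (C × Ct) (B × Bt) (C × Ct)

attribute [instance] PPTAssistedLOCC.fintypeBt PPTAssistedLOCC.decEqBt
  PPTAssistedLOCC.fintypeCt PPTAssistedLOCC.decEqCt

/-- The tensor product of a tripartite state with a state of additional systems of Bob and Charlie. -/
def adjoin {A B C Bt Ct : Type} (ω : Matrix (A × B × C) (A × B × C) ℂ)
    (μ : Matrix (Bt × Ct) (Bt × Ct) ℂ) :
    Matrix (A × (B × Bt) × (C × Ct)) (A × (B × Bt) × (C × Ct)) ℂ :=
  Matrix.of fun x y =>
    ω (x.1, x.2.1.1, x.2.2.1) (y.1, y.2.1.1, y.2.2.1) *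
      μ (x.2.1.2, x.2.2.2) (y.2.1.2, y.2.2.2)

/-- The partial trace over the additional systems of Bob and Charlie. -/
def traceOut {A B C Bt Ct : Type} [Fintype Bt] [Fintype Ct]
    (X : Matrix (A × (B × Bt) × (C × Ct)) (A × (B × Bt) × (C × Ct)) ℂ) :
    Matrix (A × B × C) (A × B × C) ℂ :=
  Matrix.of fun x y => ∑ bt : Bt, ∑ ct : Ct,
    X (x.1, (x.2.1, bt), (x.2.2, ct)) (y.1, (y.2.1, bt), (y.2.2, ct))

/-- `Λ_PPT(ω) = Tr_{Bt Ct} [Λ_LOCC [ω ⊗ μ_PPT]]`. -/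
def PPTAssistedLOCC.apply {A B C : Type} [Fintype A] [DecidableEq A]
    [Fintype B] [DecidableEq B] [Fintype C] [DecidableEq C] (P : PPTAssistedLOCC B C)
    (ω : Matrix (A × B × C) (A × B × C) ℂ) : Matrix (A × B × C) (A × B × C) ℂ :=
  traceOut (P.protocol.run (adjoin ω P.μ))

/-- The tensor product of a tripartite state with a state of Charlie's register `R`. -/
def withRegister {A B C R : Type} (ρ : Matrix (A × B × C) (A × B × C) ℂ) (ρR : Matrix R R ℂ) :
    Matrix (A × B × (C × R)) (A × B × (C × R)) ℂ :=
  Matrix.of fun x y =>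
    ρ (x.1, x.2.1, x.2.2.1) (y.1, y.2.1, y.2.2.1) * ρR x.2.2.2 y.2.2.2

/-- The partial trace over Bob's system. -/
def traceBob {A B C : Type} [Fintype B] (X : Matrix (A × B × C) (A × B × C) ℂ) :
    Matrix (A × C) (A × C) ℂ :=
  Matrix.of fun x y => ∑ b : B, X (x.1, b, x.2) (y.1, b, y.2)

/-- The final state `σ_f = Tr_B [Λ_PPT [ρ ⊗ ρR]]` of Alice and Charlie. The register `R` has the
same dimension as Bob's system `B`. -/
def finalState {A B C : Type} [Fintype A] [DecidableEq A]
    [Fintype B] [DecidableEq B] [Fintype C] [DecidableEq C]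
    (ρ : Matrix (A × B × C) (A × B × C) ℂ) (ρR : Matrix B B ℂ) (P : PPTAssistedLOCC B (C × B)) :
    Matrix (A × (C × B)) (A × (C × B)) ℂ :=
  traceBob (P.apply (withRegister ρ ρR))

/-- The target state `σ_t` of Alice and Charlie: the state `ρ` with `B` relabelled as the
register `R` of Charlie. -/
def targetState {A B C : Type} (ρ : Matrix (A × B × C) (A × B × C) ℂ) :
    Matrix (A × (C × B)) (A × (C × B)) ℂ :=
  Matrix.of fun x y => ρ (x.1, x.2.2, x.2.1) (y.1, y.2.2, y.2.1)

/-- The fidelity of PPT quantum state merging: the supremum of `F(σ_f, σ_t)` over all PPT assisted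
LOCC protocols and all initial states of the register. -/
def fidelityPQSM {A B C : Type} [Fintype A] [DecidableEq A]
    [Fintype B] [DecidableEq B] [Fintype C] [DecidableEq C]
    (ρ : Matrix (A × B × C) (A × B × C) ℂ) : ℝ :=
  sSup {f : ℝ | ∃ (P : PPTAssistedLOCC B (C × B)) (ρR : Matrix B B ℂ),
    IsDensity ρR ∧ f = fidelity (finalState ρ ρR P) (targetState ρ)}

/-- `n` copies of a tripartite state, as a tripartite state of `n`-fold systems. -/
def copies {A B C : Type} (n : ℕ) (ρ : Matrix (A × B × C) (A × B × C) ℂ) :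
    Matrix ((Fin n → A) × (Fin n → B) × (Fin n → C)) ((Fin n → A) × (Fin n → B) × (Fin n → C)) ℂ :=
  Matrix.of fun x y => ∏ k, ρ (x.1 k, x.2.1 k, x.2.2 k) (y.1 k, y.2.1 k, y.2.2 k)

/-- The asymptotic fidelity of PPT quantum state merging of `ρ` exists and equals `L`. -/
def HasAsymptoticFidelityPQSM {A B C : Type} [Fintype A] [DecidableEq A]
    [Fintype B] [DecidableEq B] [Fintype C] [DecidableEq C]
    (ρ : Matrix (A × B × C) (A × B × C) ℂ) (L : ℝ) : Prop :=
  Tendsto (fun n : ℕ => fidelityPQSM (copies n ρ)) atTop (𝓝 L)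

/-- Perfect asymptotic PPT quantum state merging. -/
def AdmitsPerfectAsymptoticPQSM {A B C : Type} [Fintype A] [DecidableEq A]
    [Fintype B] [DecidableEq B] [Fintype C] [DecidableEq C]
    (ρ : Matrix (A × B × C) (A × B × C) ℂ) : Prop :=
  HasAsymptoticFidelityPQSM ρ 1

/-- The identity and the three Pauli matrices. -/
def pauli : Fin 4 → Matrix (Fin 2) (Fin 2) ℂ :=
  ![1, !![0, 1; 1, 0], !![0, -Complex.I; Complex.I, 0], !![1, 0; 0, -1]]

/-- The generalized Bloch vector in `ℝ¹⁵` of a two-qubit state `σ`: its coordinates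
`Tr (σ (s_j ⊗ s_k))`, `(j, k) ≠ (0, 0)`, with respect to the orthogonal basis of the traceless
Hermitian matrices that consists of products of Pauli matrices. -/
def blochVector (σ : Matrix (Fin 2 × Fin 2) (Fin 2 × Fin 2) ℂ) :
    {jk : Fin 4 × Fin 4 // jk ≠ (0, 0)} → ℝ :=
  fun jk => (σ * (pauli jk.1.1 ⊗ₖ pauli jk.1.2)).trace.re

/-- The state `∑ i, p i |i⟩⟨i| ⊗ σ i`. -/
def rhoSep (p : Fin 15 → ℝ) (σ : Fin 15 → Matrix (Fin 2 × Fin 2) (Fin 2 × Fin 2) ℂ) :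
    Matrix (Fin 15 × Fin 2 × Fin 2) (Fin 15 × Fin 2 × Fin 2) ℂ :=
  ∑ i, p i • (Matrix.single i i (1 : ℂ) ⊗ₖ σ i)

end

/-! The proof shows that the merging fidelity cannot increase with the number of copies, and that it
is already below one for a single copy.

Monotonicity: the reduced state of Bob and Charlie of `rhoSep` is separable, hence PPT. A merging
protocol for `n + 1` copies can therefore be run on `n` copies: Bob and Charlie supply the reduced
state of the missing copy as part of their PPT resource and discard the surplus output
(`fidelityPQSM_le_of_tensor`). Fidelity does not decrease under partial traces, so the sequence is
antitone. It converges, and its limit is at most the one-copy value.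

One copy: every merging protocol acts as a channel `Γ` from `B × C` to Charlie. LOCC stays positive
under conjugation by the partial transposition, the resource is PPT and Bob is traced out at the
end, so `Γ` composed with the partial transposition is still positive (`isPos_mergeMap_ptMap`).
Channels that satisfy this constraint on one fixed input form a compact set of Choi matrices. If
none of them merges exactly, the fidelity is uniformly below one (`fidelityPQSM_lt_one`).

Exact merging would make `Γ`, followed by the swap, fix all fifteen states. These span only a
hyperplane of the sixteen-dimensional operator space, so such a map differs from the identity by a
map of rank at most one, `X ↦ Tr(X G) Z`. Its Choi matrix is a rank one projection, up to scale,
plus `Gᵀ ⊗ Z`. If `G` and `Z` are nonzero, both have eigenvalues of both signs, so the tensor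
product has two negative directions, and a rank one term cannot compensate both
(`eq_zero_of_eq_add_trace_smul`). Hence `Γ` is the swap, which sends the partially transposed Bell
state to an operator that is not positive (`not_transfers`). -/

set_option linter.unusedSectionVars false

/-! ### Polar decomposition and Uhlmann's description of the fidelity -/

noncomputable section

variable {S T E : Type} [Fintype S] [Fintype T] [Fintype E]

lemma continuousOn_spectrum [DecidableEq S] (H : Matrix S S ℂ) (f : ℝ → ℝ) :
    ContinuousOn f (spectrum ℝ H) :=
  (Matrix.finite_real_spectrum (A := H)).continuousOn f

/-- Polar decomposition with a partial isometry. -/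
lemma exists_polar [DecidableEq S] (A : Matrix S T ℂ) :
    ∃ W : Matrix S T ℂ, W * Wᴴ * W = W ∧ CFC.sqrt (A * Aᴴ) * W = A ∧
      A * Wᴴ = CFC.sqrt (A * Aᴴ) := by
  set H := A * Aᴴ with hH
  have hpsd : H.PosSemidef := posSemidef_self_mul_conjTranspose A
  have h0 : 0 ≤ H := nonneg_iff_posSemidef.2 hpsd
  have hsa : IsSelfAdjoint H := hpsd.1
  -- Since `0⁻¹ = 0`, this is the pseudoinverse of `√H`; then `P = √H * D` is the support projection
  -- of `H`, and `D * A` is the required partial isometry.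
  set D := cfc (fun x : ℝ => (√x)⁻¹) H with hD
  have hDh : Dᴴ = D := IsSelfAdjoint.cfc (f := fun x : ℝ => (√x)⁻¹) (a := H)
  have hc := continuousOn_spectrum H
  have hs : CFC.sqrt H = cfc Real.sqrt H := by
    rw [CFC.sqrt_eq_real_sqrt H h0, cfcₙ_eq_cfc (f := Real.sqrt) (a := H)]
  have hid : cfc (fun x : ℝ => x) H = H := cfc_id' ℝ H
  have hspec : ∀ x ∈ spectrum ℝ H, 0 ≤ x := fun x hx => spectrum_nonneg_of_nonneg h0 hx
  set P := CFC.sqrt H * D with hP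
  have hPe : P = cfc (fun x : ℝ => √x * (√x)⁻¹) H := by
    rw [hP, hs, hD, ← cfc_mul _ _ H (hc _) (hc _)]
  have hPh : Pᴴ = P := by rw [hPe]; exact IsSelfAdjoint.cfc
  have hHD : H * D = CFC.sqrt H := by
    nth_rewrite 1 [← hid]
    rw [hs, hD, ← cfc_mul _ _ H (hc _) (hc _)]
    refine cfc_congr fun x hx => ?_
    rcases eq_or_lt_of_le (hspec x hx) with h | h
    · simp [← h]
    · have := Real.sqrt_pos.2 h
      field_simp
      exact (Real.sq_sqrt h.le).symm
  have hPH : P * H = H := by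
    calc P * H = P * cfc (fun x : ℝ => x) H := by rw [hid]
      _ = cfc (fun x : ℝ => x) H := ?_
      _ = H := hid
    rw [hPe, ← cfc_mul _ _ H (hc _) (hc _)]
    refine cfc_congr fun x hx => ?_
    rcases eq_or_lt_of_le (hspec x hx) with h | h
    · simp [← h]
    · have := Real.sqrt_pos.2 h
      field_simp
  have hPA : P * A = A := by
    have : (P * A - A) * (P * A - A)ᴴ = 0 := by
      have : (P * A - A) * (P * A - A)ᴴ = P * H * Pᴴ - P * H - (P * H)ᴴ + H := by
        simp only [conjTranspose_sub, conjTranspose_mul, hH, conjTranspose_conjTranspose,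
          Matrix.mul_sub, Matrix.sub_mul, Matrix.mul_assoc]
        abel
      rw [this, hPH, hPh, hpsd.1.eq]
      have h2 : H * P = H := by
        have := congrArg conjTranspose hPH
        rwa [conjTranspose_mul, hpsd.1.eq, hPh] at this
      rw [h2]; abel
    exact sub_eq_zero.1 (Matrix.self_mul_conjTranspose_eq_zero.1 this)
  have hDs : D * CFC.sqrt H = P := by
    rw [← hPh, hP, conjTranspose_mul, hDh]; congr 1
    exact (IsSelfAdjoint.of_nonneg (CFC.sqrt_nonneg H)).symm
  have hDHD : D * A * (D * A)ᴴ = P := by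
    rw [conjTranspose_mul, hDh, ← hDs, ← hHD, hH]; simp only [Matrix.mul_assoc]
  refine ⟨D * A, ?_, ?_, ?_⟩
  · rw [hDHD, ← Matrix.mul_assoc, ← hDs, Matrix.mul_assoc D, ← hP, Matrix.mul_assoc, hPA]
  · rw [← Matrix.mul_assoc, ← hP, hPA]
  · rw [conjTranspose_mul, hDh, ← hHD, hH, Matrix.mul_assoc]

lemma posSemidef_one_sub_of_partialIsometry [DecidableEq T] {W : Matrix S T ℂ}
    (h : W * Wᴴ * W = W) : (1 - Wᴴ * W).PosSemidef := by
  have : 1 - Wᴴ * W = (1 - Wᴴ * W)ᴴ * (1 - Wᴴ * W) := by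
    have h2 : Wᴴ * W * (Wᴴ * W) = Wᴴ * W := by
      rw [Matrix.mul_assoc, ← Matrix.mul_assoc W, h]
    simp only [conjTranspose_sub, conjTranspose_one, conjTranspose_mul, conjTranspose_conjTranspose,
      Matrix.sub_mul, Matrix.mul_sub, Matrix.one_mul, Matrix.mul_one, h2]
    abel
  rw [this]
  exact posSemidef_conjTranspose_mul_self _

lemma partialIsometry_conjTranspose {W : Matrix S T ℂ} (h : W * Wᴴ * W = W) :
    Wᴴ * Wᴴᴴ * Wᴴ = Wᴴ := by
  have := congrArg conjTranspose h
  simpa [Matrix.mul_assoc] using this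

/-- Multiplication by a partial isometry does not increase the Frobenius norm. -/
lemma trace_mul_partialIsometry_le {R : Type} [Fintype R] {W : Matrix S T ℂ}
    (h : W * Wᴴ * W = W) (Q : Matrix R S ℂ) :
    ((Q * W) * (Q * W)ᴴ).trace.re ≤ (Q * Qᴴ).trace.re := by
  classical
  have h1 := posSemidef_one_sub_of_partialIsometry (partialIsometry_conjTranspose h)
  have h2 := (h1.mul_mul_conjTranspose_same Q).trace_nonneg
  have h3 : Q * (1 - Wᴴᴴ * Wᴴ) * Qᴴ = Q * Qᴴ - (Q * W) * (Q * W)ᴴ := by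
    simp only [conjTranspose_mul, conjTranspose_conjTranspose, Matrix.mul_sub, Matrix.sub_mul,
      Matrix.mul_one, Matrix.mul_assoc]
  rw [h3, trace_sub] at h2
  have := (Complex.le_def.1 h2).1
  simpa using this

lemma trace_mul_conjTranspose_eq (A B : Matrix S T ℂ) :
    (A * Bᴴ).trace = ∑ x, ∑ t, A x t * star (B x t) := by
  simp [Matrix.trace, Matrix.mul_apply]

lemma trace_self_mul_conjTranspose_re (A : Matrix S T ℂ) :
    (A * Aᴴ).trace.re = ∑ x, ∑ t, ‖A x t‖ ^ 2 := by
  rw [trace_mul_conjTranspose_eq]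
  simp only [Complex.re_sum, Complex.star_def, Complex.mul_conj, Complex.normSq_eq_norm_sq,
    Complex.ofReal_re]

lemma trace_sub_mul_conjTranspose (A B : Matrix S T ℂ) :
    ((A - B) * (A - B)ᴴ).trace.re =
      (A * Aᴴ).trace.re + (B * Bᴴ).trace.re - 2 * (A * Bᴴ).trace.re := by
  have : (B * Aᴴ).trace.re = (A * Bᴴ).trace.re := by
    have : B * Aᴴ = (A * Bᴴ)ᴴ := by simp
    rw [this, trace_conjTranspose]; simp
  rw [conjTranspose_sub, Matrix.sub_mul, Matrix.mul_sub, Matrix.mul_sub]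
  simp only [trace_sub, Complex.sub_re, this]
  ring

lemma two_mul_re_trace_le (A B : Matrix S T ℂ) :
    2 * (A * Bᴴ).trace.re ≤ (A * Aᴴ).trace.re + (B * Bᴴ).trace.re := by
  have h := trace_sub_mul_conjTranspose A B
  have : 0 ≤ ((A - B) * (A - B)ᴴ).trace.re := by
    rw [trace_self_mul_conjTranspose_re]; positivity
  linarith

lemma conjTranspose_cfcSqrt [DecidableEq S] (ρ : Matrix S S ℂ) :
    (CFC.sqrt ρ)ᴴ = CFC.sqrt ρ :=
  IsSelfAdjoint.of_nonneg (CFC.sqrt_nonneg ρ)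

lemma cfcSqrt_mul_self [DecidableEq S] {ρ : Matrix S S ℂ} (h : ρ.PosSemidef) :
    CFC.sqrt ρ * CFC.sqrt ρ = ρ :=
  CFC.sqrt_mul_sqrt_self ρ (nonneg_iff_posSemidef.2 h)

/-- The upper bound in Uhlmann's theorem. With `A = √ρ W₁`, `B = √σ W₂` and `√ρ √σ = N W₃`, the
overlap is a trace of `N` against partial isometries. Splitting `N = Y * Y` makes it an inner
product of two matrices whose squared norms are at most `Tr N`, which is the fidelity. -/
lemma re_trace_mul_conjTranspose_le_fidelity [DecidableEq S] (A B : Matrix S T ℂ) :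
    (A * Bᴴ).trace.re ≤ fidelity (A * Aᴴ) (B * Bᴴ) := by
  obtain ⟨W₁, hW₁, hA, -⟩ := exists_polar A
  obtain ⟨W₂, hW₂, hB, -⟩ := exists_polar B
  have hσ := cfcSqrt_mul_self (posSemidef_self_mul_conjTranspose B)
  unfold fidelity
  set r := CFC.sqrt (A * Aᴴ)
  set s := CFC.sqrt (B * Bᴴ)
  have hr : rᴴ = r := conjTranspose_cfcSqrt _
  have hs : sᴴ = s := conjTranspose_cfcSqrt _
  obtain ⟨W₃, hW₃, hM, -⟩ := exists_polar (r * s)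
  have hMM : r * s * (r * s)ᴴ = r * (B * Bᴴ) * r := by
    rw [conjTranspose_mul, hr, hs, ← hσ]; noncomm_ring
  rw [hMM] at hM
  set N := CFC.sqrt (r * (B * Bᴴ) * r) with hN
  have hY := cfcSqrt_mul_self (nonneg_iff_posSemidef.1 (CFC.sqrt_nonneg (r * (B * Bᴴ) * r)))
  rw [← hN] at hY
  set Y := CFC.sqrt N
  have hYh : Yᴴ = Y := conjTranspose_cfcSqrt _
  have hYY : Y * Yᴴ = N := by rw [hYh, hY]
  have e : (A * Bᴴ).trace = ((Y * W₃ * W₂) * (Y * W₁)ᴴ).trace.re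
      - (((Y * W₃ * W₂) * (Y * W₁)ᴴ).trace).im * Complex.I := by
    have h1 : (A * Bᴴ)ᴴ = s * W₂ * W₁ᴴ * r := by
      rw [← hA, ← hB]; simp only [conjTranspose_mul, conjTranspose_conjTranspose, hr, hs,
        Matrix.mul_assoc]
    have h2 : (A * Bᴴ)ᴴ.trace = ((Y * W₃ * W₂) * (Y * W₁)ᴴ).trace := by
      rw [h1, Matrix.trace_mul_comm, ← Matrix.mul_assoc, ← Matrix.mul_assoc, ← hM, ← hY,
        conjTranspose_mul, hYh, ← Matrix.mul_assoc (Y * W₃ * W₂),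
        Matrix.trace_mul_comm (Y * W₃ * W₂ * W₁ᴴ)]
      simp only [Matrix.mul_assoc]
    rw [← h2, trace_conjTranspose]
    apply Complex.ext <;> simp
  have e' : (A * Bᴴ).trace.re = ((Y * W₃ * W₂) * (Y * W₁)ᴴ).trace.re := by
    rw [e]; simp
  have b1 := two_mul_re_trace_le (Y * W₃ * W₂) (Y * W₁)
  have b2 := trace_mul_partialIsometry_le hW₁ Y
  have b3 := trace_mul_partialIsometry_le hW₂ (Y * W₃)
  have b4 := trace_mul_partialIsometry_le hW₃ Y
  rw [hYY] at b2 b4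
  linarith

/-- Attainment in Uhlmann's theorem. The polar factor `W` of `√ρ √σ` may fail to be unitary, so `√σ
Wᴴ` alone may lose part of `σ`; a second block of columns, built from the projection `1 - Wᴴ W`,
restores it without changing the overlap. -/
lemma exists_fidelity_eq [DecidableEq S] {ρ σ : Matrix S S ℂ} (hρ : ρ.PosSemidef)
    (hσ : σ.PosSemidef) : ∃ A B : Matrix S (S ⊕ S) ℂ, A * Aᴴ = ρ ∧ B * Bᴴ = σ ∧
      (A * Bᴴ).trace.re = fidelity ρ σ := by
  have hr2 := cfcSqrt_mul_self hρ
  have hs2 := cfcSqrt_mul_self hσ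
  unfold fidelity
  set r := CFC.sqrt ρ
  set s := CFC.sqrt σ
  have hr : rᴴ = r := conjTranspose_cfcSqrt _
  have hs : sᴴ = s := conjTranspose_cfcSqrt _
  obtain ⟨W, hW, -, hM⟩ := exists_polar (r * s)
  have hMM : r * s * (r * s)ᴴ = r * σ * r := by
    rw [conjTranspose_mul, hr, hs, ← hs2]; noncomm_ring
  rw [hMM] at hM
  have hQ : (1 - Wᴴ * W) * (1 - Wᴴ * W)ᴴ = 1 - Wᴴ * W := by
    have h2 : Wᴴ * W * (Wᴴ * W) = Wᴴ * W := by
      rw [Matrix.mul_assoc, ← Matrix.mul_assoc W, hW]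
    simp only [conjTranspose_sub, conjTranspose_one, conjTranspose_mul, conjTranspose_conjTranspose,
      Matrix.sub_mul, Matrix.mul_sub, Matrix.one_mul, Matrix.mul_one, h2]
    abel
  refine ⟨fromCols r 0, fromCols (s * Wᴴ) (s * (1 - Wᴴ * W)), ?_, ?_, ?_⟩
  · rw [conjTranspose_fromCols_eq_fromRows_conjTranspose, fromCols_mul_fromRows, hr, hr2]; simp
  · rw [conjTranspose_fromCols_eq_fromRows_conjTranspose, fromCols_mul_fromRows,
      conjTranspose_mul s (1 - _), Matrix.mul_assoc s (1 - _), ← Matrix.mul_assoc (1 - _), hQ, hs,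
      conjTranspose_mul, hs, ← hs2]
    simp only [conjTranspose_conjTranspose]
    noncomm_ring
  · rw [conjTranspose_fromCols_eq_fromRows_conjTranspose, fromCols_mul_fromRows, ← hM]
    simp only [Matrix.zero_mul, add_zero, conjTranspose_mul, conjTranspose_conjTranspose, hs]
    rw [← Matrix.mul_assoc, ← hr]
    have : (rᴴ * W * s).trace = star ((s * Wᴴ * r).trace) := by
      rw [← trace_conjTranspose]
      simp [hs, Matrix.mul_assoc]
    rw [this, Matrix.mul_assoc, Matrix.trace_mul_comm, hr]
    have h4 : (Wᴴ * r * s).trace = (r * s * Wᴴ).trace := by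
      rw [Matrix.mul_assoc, Matrix.trace_mul_comm]
    rw [h4]; simp

lemma fidelity_le_one [DecidableEq S] {ρ σ : Matrix S S ℂ} (hρ : IsDensity ρ)
    (hσ : IsDensity σ) : fidelity ρ σ ≤ 1 := by
  obtain ⟨A, B, hA, hB, h⟩ := exists_fidelity_eq hρ.1 hσ.1
  have := two_mul_re_trace_le A B
  rw [hA, hB, hρ.2, hσ.2, h] at this
  simp at this
  linarith

lemma fidelity_nonneg [DecidableEq S] (ρ σ : Matrix S S ℂ) : 0 ≤ fidelity ρ σ :=
  (Complex.le_def.1 (nonneg_iff_posSemidef.1 (CFC.sqrt_nonneg _)).trace_nonneg).1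

/-- For optimal `A`, `B` the squared Frobenius distance is `d = 2 - 2F`. Writing `ρ - σ = (A - B)Aᴴ
+ B(A - B)ᴴ`, Cauchy–Schwarz bounds the square of each summand's entry by `d`, so their sum
contributes at most `4d`. -/
lemma norm_sq_sub_le_of_fidelity [DecidableEq S] {ρ σ : Matrix S S ℂ} (hρ : IsDensity ρ)
    (hσ : IsDensity σ) (x y : S) : ‖ρ x y - σ x y‖ ^ 2 ≤ 8 * (1 - fidelity ρ σ) := by
  obtain ⟨A, B, hA, hB, h⟩ := exists_fidelity_eq hρ.1 hσ.1
  have hD := trace_sub_mul_conjTranspose A B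
  rw [hA, hB, hρ.2, hσ.2, h] at hD
  have hA1 : (A * Aᴴ).trace.re = 1 := by rw [hA, hρ.2]; simp
  have hB1 : (B * Bᴴ).trace.re = 1 := by rw [hB, hσ.2]; simp
  rw [trace_self_mul_conjTranspose_re] at hD hA1 hB1
  have row (M : Matrix S (S ⊕ S) ℂ) (z : S) :
      ∑ t, ‖M z t‖ ^ 2 ≤ ∑ x, ∑ t, ‖M x t‖ ^ 2 :=
    Finset.single_le_sum (f := fun x => ∑ t, ‖M x t‖ ^ 2) (fun _ _ => by positivity)
      (Finset.mem_univ z)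
  have cs (M N : Matrix S (S ⊕ S) ℂ) :
      ‖∑ t, M x t * star (N y t)‖ ^ 2 ≤ (∑ t, ‖M x t‖ ^ 2) * ∑ t, ‖N y t‖ ^ 2 := by
    refine le_trans ?_ (Finset.sum_mul_sq_le_sq_mul_sq Finset.univ (fun t => ‖M x t‖)
      (fun t => ‖N y t‖))
    gcongr
    refine (norm_sum_le _ _).trans_eq ?_
    simp
  have e : ρ x y - σ x y =
      ∑ t, (A - B) x t * star (A y t) + ∑ t, B x t * star ((A - B) y t) := by
    rw [← hA, ← hB]
    simp only [Matrix.mul_apply, conjTranspose_apply, ← Finset.sum_sub_distrib,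
      ← Finset.sum_add_distrib, Matrix.sub_apply, star_sub]
    refine Finset.sum_congr rfl fun t _ => ?_
    ring
  have h1 := cs (A - B) A
  have h2 := cs B (A - B)
  set d := ∑ x, ∑ t, ‖(A - B) x t‖ ^ 2
  have hd : d = 2 - 2 * fidelity ρ σ := by rw [hD]; simp; ring
  have h1' : ‖∑ t, (A - B) x t * star (A y t)‖ ^ 2 ≤ d := by
    refine h1.trans ?_
    have := mul_le_mul (row (A - B) x) (row A y) (by positivity) (by positivity)
    rw [hA1, mul_one] at this; exact this
  have h2' : ‖∑ t, B x t * star ((A - B) y t)‖ ^ 2 ≤ d := by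
    refine h2.trans ?_
    have := mul_le_mul (row B x) (row (A - B) y) (by positivity) (by positivity)
    rw [hB1, one_mul] at this; exact this
  rw [e]
  have h3 := norm_add_le (∑ t, (A - B) x t * star (A y t)) (∑ t, B x t * star ((A - B) y t))
  have h4 := norm_nonneg (∑ t, (A - B) x t * star (A y t) + ∑ t, B x t * star ((A - B) y t))
  set a := ‖∑ t, (A - B) x t * star (A y t)‖
  set b := ‖∑ t, B x t * star ((A - B) y t)‖
  calc _ ≤ (a + b) ^ 2 := by gcongr
    _ ≤ 2 * (a ^ 2 + b ^ 2) := by nlinarith [sq_nonneg (a - b)]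
    _ ≤ 8 * (1 - fidelity ρ σ) := by linarith

/-- The partial trace over the second factor of `S × E`, along an identification `R ≃ S × E`. -/
def traceAlong {R : Type} (e : R ≃ S × E) (X : Matrix R R ℂ) : Matrix S S ℂ :=
  Matrix.of fun x y => ∑ k : E, X (e.symm (x, k)) (e.symm (y, k))

/-- Moving the traced index from the rows of `A` and `B` to their columns turns factorizations of
the states into factorizations of the partial traces with the same overlap. -/
lemma fidelity_le_fidelity_traceAlong {R : Type} [Fintype R] [DecidableEq R] [DecidableEq S]
    (e : R ≃ S × E) {ρ σ : Matrix R R ℂ} (hρ : ρ.PosSemidef) (hσ : σ.PosSemidef) :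
    fidelity ρ σ ≤ fidelity (traceAlong e ρ) (traceAlong e σ) := by
  obtain ⟨A, B, hA, hB, h⟩ := exists_fidelity_eq hρ hσ
  let f (M : Matrix R (R ⊕ R) ℂ) : Matrix S (E × (R ⊕ R)) ℂ :=
    Matrix.of fun x k => M (e.symm (x, k.1)) k.2
  have hf (M N : Matrix R (R ⊕ R) ℂ) : f M * (f N)ᴴ = traceAlong e (M * Nᴴ) := by
    ext x y
    simp [f, traceAlong, Matrix.mul_apply, Fintype.sum_prod_type]
  have ht (X : Matrix R R ℂ) : (traceAlong e X).trace = X.trace := by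
    simp only [Matrix.trace, traceAlong, Matrix.diag, Matrix.of_apply]
    rw [← Fintype.sum_prod_type', e.symm.sum_comp (fun r => X r r)]
  have := re_trace_mul_conjTranspose_le_fidelity (f A) (f B)
  rwa [hf, hf, hf, ht, hA, hB, h] at this
end

/-! ### Protocols as channels, and their behaviour under partial transposition -/

noncomputable section

/-- Operators on the Hilbert space with orthonormal basis `S`. -/
abbrev Op (S : Type) := Matrix S S ℂ

section maps

variable {A S T U : Type}

/-- The `(a, a')` block of an operator on `A × S`. -/
def block (X : Op (A × S)) (a a' : A) : Op S := Matrix.of fun u v => X (a, u) (a', v)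

/-- The amplification `id ⊗ Ψ` of a linear map `Ψ` of operators. -/
def ampl (A : Type) (Ψ : Op S →ₗ[ℂ] Op T) (X : Op (A × S)) : Op (A × T) :=
  Matrix.of fun x y => Ψ (block X x.1 y.1) x.2 y.2

lemma block_ampl (Ψ : Op S →ₗ[ℂ] Op T) (X : Op (A × S)) (a a' : A) :
    block (ampl A Ψ X) a a' = Ψ (block X a a') := rfl

lemma ampl_comp (Φ : Op T →ₗ[ℂ] Op U) (Ψ : Op S →ₗ[ℂ] Op T) (X : Op (A × S)) :
    ampl A (Φ ∘ₗ Ψ) X = ampl A Φ (ampl A Ψ X) := rfl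

lemma ampl_sum {ι : Type} (s : Finset ι) (Ψ : ι → Op S →ₗ[ℂ] Op T) (X : Op (A × S)) :
    ampl A (∑ i ∈ s, Ψ i) X = ∑ i ∈ s, ampl A (Ψ i) X := by
  ext x y
  simp [ampl, Matrix.sum_apply]

/-- The map `X ↦ K X Kᴴ`. -/
def krausMap [Fintype S] (K : Matrix T S ℂ) : Op S →ₗ[ℂ] Op T where
  toFun X := K * X * Kᴴ
  map_add' X Y := by rw [Matrix.mul_add, Matrix.add_mul]
  map_smul' c X := by simp

lemma krausMap_kronecker_one_apply {R : Type} [Fintype S] [Fintype R] [DecidableEq R]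
    (K : Matrix T S ℂ) (X : Op (S × R)) (x y : T × R) :
    krausMap (K ⊗ₖ (1 : Op R)) X x y =
      ∑ k, ∑ l, K x.1 l * X (l, x.2) (k, y.2) * star (K y.1 k) := by
  simp only [krausMap, LinearMap.coe_mk, AddHom.coe_mk, Matrix.mul_apply, Fintype.sum_prod_type,
    kroneckerMap_apply, Matrix.one_apply, conjTranspose_apply, mul_ite, mul_one, mul_zero,
    ite_mul, zero_mul, apply_ite star, star_zero, Finset.sum_ite_eq, Finset.mem_univ, if_true,
    Finset.sum_mul]

lemma krausMap_one_kronecker_apply {R : Type} [Fintype S] [Fintype R] [DecidableEq R]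
    (K : Matrix T S ℂ) (X : Op (R × S)) (x y : R × T) :
    krausMap ((1 : Op R) ⊗ₖ K) X x y =
      ∑ k, ∑ l, K x.2 l * X (x.1, l) (y.1, k) * star (K y.2 k) := by
  simp only [krausMap, LinearMap.coe_mk, AddHom.coe_mk, Matrix.mul_apply,
    Fintype.sum_prod_type_right, kroneckerMap_apply, Matrix.one_apply, conjTranspose_apply,
    ite_mul, one_mul, zero_mul, mul_ite, mul_zero, apply_ite star, star_zero, Finset.sum_ite_eq,
    Finset.mem_univ, if_true, Finset.sum_mul]

lemma ampl_krausMap [Fintype A] [DecidableEq A] [Fintype S] (K : Matrix T S ℂ) (X : Op (A × S)) :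
    ampl A (krausMap K) X = ((1 : Op A) ⊗ₖ K) * X * ((1 : Op A) ⊗ₖ K)ᴴ := by
  ext x y
  refine Eq.trans ?_ (krausMap_one_kronecker_apply K X x y).symm
  simp only [ampl, krausMap, block, of_apply, LinearMap.coe_mk, AddHom.coe_mk, Matrix.mul_apply,
    conjTranspose_apply, Finset.sum_mul]

lemma sum_conjTranspose_mul_kronecker_one {ι R : Type} [Fintype ι] [Fintype S] [DecidableEq S]
    [Fintype T] [Fintype R] [DecidableEq R] {K : ι → Matrix T S ℂ}
    (hK : ∑ x, (K x)ᴴ * K x = 1) :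
    ∑ x, (K x ⊗ₖ (1 : Op R))ᴴ * (K x ⊗ₖ (1 : Op R)) = 1 := by
  simp only [conjTranspose_kronecker, ← mul_kronecker_mul, conjTranspose_one, Matrix.one_mul]
  rw [← Matrix.one_kronecker_one, ← hK]
  ext i j
  simp [Matrix.sum_apply, Finset.sum_mul]

lemma sum_conjTranspose_mul_one_kronecker {ι R : Type} [Fintype ι] [Fintype S] [DecidableEq S]
    [Fintype T] [Fintype R] [DecidableEq R] {K : ι → Matrix T S ℂ}
    (hK : ∑ x, (K x)ᴴ * K x = 1) :
    ∑ x, ((1 : Op R) ⊗ₖ K x)ᴴ * ((1 : Op R) ⊗ₖ K x) = 1 := by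
  simp only [conjTranspose_kronecker, ← mul_kronecker_mul, conjTranspose_one, Matrix.one_mul]
  rw [← Matrix.one_kronecker_one, ← hK]
  ext i j
  simp [Matrix.sum_apply, Finset.mul_sum]

/-- Complete positivity. -/
def IsCP [Fintype S] [Fintype T] (Ψ : Op S →ₗ[ℂ] Op T) : Prop :=
  ∀ (A : Type) [Fintype A] (X : Op (A × S)), X.PosSemidef → (ampl A Ψ X).PosSemidef

def IsTP [Fintype S] [Fintype T] (Ψ : Op S →ₗ[ℂ] Op T) : Prop :=
  ∀ X, (Ψ X).trace = X.trace

def IsPos [Fintype S] [Fintype T] (Ψ : Op S →ₗ[ℂ] Op T) : Prop :=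
  ∀ X, X.PosSemidef → (Ψ X).PosSemidef

end maps

section locc

variable {B' C' B'' C'' : Type} [Fintype B'] [DecidableEq B'] [Fintype C'] [DecidableEq C']
  [Fintype B''] [DecidableEq B''] [Fintype C''] [DecidableEq C'']

/-- The quantum channel on the systems of Bob and Charlie realized by a protocol. -/
def LOCC.toMap : {B C : Type} → [Fintype B] → [DecidableEq B] → [Fintype C] → [DecidableEq C] →
    LOCC B' C' B C → (Op (B × C) →ₗ[ℂ] Op (B' × C'))
  | _, _, _, _, _, _, .done => LinearMap.id
  | _, _, _, _, _, _, @LOCC.bob _ _ _ _ _ _ _ C _ _ _ _ _ _ _ _ K _ next =>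
      ∑ x, (next x).toMap ∘ₗ krausMap (K x ⊗ₖ (1 : Op C))
  | _, _, _, _, _, _, @LOCC.charlie _ _ _ _ _ _ B _ _ _ _ _ _ _ _ _ K _ next =>
      ∑ x, (next x).toMap ∘ₗ krausMap ((1 : Op B) ⊗ₖ K x)

lemma LOCC.run_eq_ampl {A : Type} [Fintype A] [DecidableEq A] {B C : Type} [Fintype B]
    [DecidableEq B] [Fintype C] [DecidableEq C] (P : LOCC B' C' B C) (X : Op (A × B × C)) :
    P.run X = ampl A P.toMap X := by
  induction P with
  | done => rfl
  | bob B₁ m K hK next ih =>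
    simp only [LOCC.run, LOCC.toMap, ampl_sum, ampl_comp, ih, ampl_krausMap]
  | charlie C₁ m K hK next ih =>
    simp only [LOCC.run, LOCC.toMap, ampl_sum, ampl_comp, ih, ampl_krausMap]

/-- Sequential composition of protocols. -/
def LOCC.append : {B C : Type} → [Fintype B] → [DecidableEq B] → [Fintype C] → [DecidableEq C] →
    LOCC B' C' B C → LOCC B'' C'' B' C' → LOCC B'' C'' B C
  | _, _, _, _, _, _, .done, Q => Q
  | _, _, _, _, _, _, @LOCC.bob _ _ _ _ _ _ _ _ _ _ _ _ B₁ _ _ m K hK next, Q =>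
      .bob B₁ m K hK fun x => (next x).append Q
  | _, _, _, _, _, _, @LOCC.charlie _ _ _ _ _ _ _ _ _ _ _ _ C₁ _ _ m K hK next, Q =>
      .charlie C₁ m K hK fun x => (next x).append Q

lemma LOCC.toMap_append {B C : Type} [Fintype B]
    [DecidableEq B] [Fintype C] [DecidableEq C] (P : LOCC B' C' B C) (Q : LOCC B'' C'' B' C') :
    (P.append Q).toMap = Q.toMap ∘ₗ P.toMap := by
  induction P with
  | done => simp only [LOCC.append, LOCC.toMap, LinearMap.comp_id]
  | bob B₁ m K hK next ih =>
    ext1 X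
    simp only [LOCC.append, LOCC.toMap, ih, LinearMap.sum_apply, LinearMap.comp_apply, map_sum]
  | charlie C₁ m K hK next ih =>
    ext1 X
    simp only [LOCC.append, LOCC.toMap, ih, LinearMap.sum_apply, LinearMap.comp_apply, map_sum]

/-- Bob measures with Kraus operators indexed by any finite type and forgets the outcome. -/
def LOCC.bobStep {B C B₁ ι : Type} [Fintype B] [DecidableEq B] [Fintype C] [DecidableEq C]
    [Fintype B₁] [DecidableEq B₁] [Fintype ι] (K : ι → Matrix B₁ B ℂ)
    (hK : ∑ x, (K x)ᴴ * K x = 1) : LOCC B₁ C B C :=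
  .bob B₁ (Fintype.card ι) (fun i => K ((Fintype.equivFin ι).symm i))
    (by rw [(Fintype.equivFin ι).symm.sum_comp (fun x => (K x)ᴴ * K x), hK]) fun _ => .done

lemma LOCC.toMap_bobStep {B C B₁ ι : Type} [Fintype B] [DecidableEq B] [Fintype C]
    [DecidableEq C] [Fintype B₁] [DecidableEq B₁] [Fintype ι] (K : ι → Matrix B₁ B ℂ)
    (hK : ∑ x, (K x)ᴴ * K x = 1) :
    (LOCC.bobStep (C := C) K hK).toMap = ∑ x, krausMap (K x ⊗ₖ (1 : Op C)) := by
  simp only [LOCC.bobStep, LOCC.toMap, LinearMap.id_comp]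
  exact (Fintype.equivFin ι).symm.sum_comp (fun x => krausMap (K x ⊗ₖ (1 : Op C)))

/-- Charlie measures with Kraus operators indexed by any finite type and forgets the outcome. -/
def LOCC.charlieStep {B C C₁ ι : Type} [Fintype B] [DecidableEq B] [Fintype C] [DecidableEq C]
    [Fintype C₁] [DecidableEq C₁] [Fintype ι] (K : ι → Matrix C₁ C ℂ)
    (hK : ∑ x, (K x)ᴴ * K x = 1) : LOCC B C₁ B C :=
  .charlie C₁ (Fintype.card ι) (fun i => K ((Fintype.equivFin ι).symm i))
    (by rw [(Fintype.equivFin ι).symm.sum_comp (fun x => (K x)ᴴ * K x), hK]) fun _ => .done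

lemma LOCC.toMap_charlieStep {B C C₁ ι : Type} [Fintype B] [DecidableEq B] [Fintype C]
    [DecidableEq C] [Fintype C₁] [DecidableEq C₁] [Fintype ι] (K : ι → Matrix C₁ C ℂ)
    (hK : ∑ x, (K x)ᴴ * K x = 1) :
    (LOCC.charlieStep (B := B) K hK).toMap = ∑ x, krausMap ((1 : Op B) ⊗ₖ K x) := by
  simp only [LOCC.charlieStep, LOCC.toMap, LinearMap.id_comp]
  exact (Fintype.equivFin ι).symm.sum_comp (fun x => krausMap ((1 : Op B) ⊗ₖ K x))

end locc

section positivity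

variable {S T U : Type} [Fintype S] [Fintype T] [Fintype U]

lemma IsCP.comp {Φ : Op T →ₗ[ℂ] Op U} {Ψ : Op S →ₗ[ℂ] Op T} (hΦ : IsCP Φ) (hΨ : IsCP Ψ) :
    IsCP (Φ ∘ₗ Ψ) := fun A _ X hX => by
  rw [ampl_comp]; exact hΦ A _ (hΨ A X hX)

lemma IsCP.sum {ι : Type} {s : Finset ι} {Ψ : ι → Op S →ₗ[ℂ] Op T} (h : ∀ i, IsCP (Ψ i)) :
    IsCP (∑ i ∈ s, Ψ i) := fun A _ X hX => by
  rw [ampl_sum]; exact posSemidef_sum _ fun i _ => h i A X hX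

lemma IsCP.isPos {Ψ : Op S →ₗ[ℂ] Op T} (h : IsCP Ψ) : IsPos Ψ := fun X hX =>
  (h Unit (X.submatrix Prod.snd Prod.snd) (hX.submatrix _)).submatrix fun t => ((), t)

lemma isCP_krausMap (K : Matrix T S ℂ) : IsCP (krausMap K) := fun A _ X hX => by
  classical
  rw [ampl_krausMap]; exact hX.mul_mul_conjTranspose_same _

lemma isPos_krausMap (K : Matrix T S ℂ) : IsPos (krausMap K) :=
  fun _ hX => hX.mul_mul_conjTranspose_same _

lemma trace_krausMap (K : Matrix T S ℂ) (X : Op S) :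
    (krausMap K X).trace = (Kᴴ * K * X).trace := by
  change (K * X * Kᴴ).trace = _
  rw [Matrix.trace_mul_comm, Matrix.mul_assoc]

end positivity

section partialTranspose

variable {B C B₁ C₁ : Type}

/-- Partial transposition as a linear map. -/
def ptMap (B C : Type) : Op (B × C) →ₗ[ℂ] Op (B × C) where
  toFun := partialTranspose
  map_add' _ _ := rfl
  map_smul' _ _ := rfl

lemma ptMap_apply (X : Op (B × C)) (x y : B × C) :
    ptMap B C X x y = X (y.1, x.2) (x.1, y.2) := rfl

/-- Transposing Bob's indices interchanges the roles of `K` and `Kᴴ`, up to transposition. The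
result is again a Kraus map, which is why LOCC survives conjugation by the partial transposition. -/
lemma ptMap_krausMap_left [Fintype B] [Fintype C] [DecidableEq C] (K : Matrix B₁ B ℂ)
    (X : Op (B × C)) :
    ptMap B₁ C (krausMap (K ⊗ₖ (1 : Op C)) (ptMap B C X)) =
      krausMap (K.map star ⊗ₖ (1 : Op C)) X := by
  ext x y
  simp only [ptMap_apply, krausMap_kronecker_one_apply, Matrix.map_apply, star_star]
  rw [Finset.sum_comm]
  refine Finset.sum_congr rfl fun _ _ => Finset.sum_congr rfl fun _ _ => by ring

lemma ptMap_krausMap_right [Fintype B] [DecidableEq B] [Fintype C] (K : Matrix C₁ C ℂ)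
    (X : Op (B × C)) :
    ptMap B C₁ (krausMap ((1 : Op B) ⊗ₖ K) (ptMap B C X)) = krausMap ((1 : Op B) ⊗ₖ K) X := by
  ext x y
  simp only [ptMap_apply, krausMap_one_kronecker_apply]

end partialTranspose

section loccprops

variable {B' C' : Type} [Fintype B'] [DecidableEq B'] [Fintype C'] [DecidableEq C']
  {B C : Type} [Fintype B] [DecidableEq B] [Fintype C] [DecidableEq C]

lemma LOCC.isCP_toMap (P : LOCC B' C' B C) : IsCP P.toMap := by
  induction P with
  | done => exact fun A _ X hX => hX
  | bob B₁ m K hK next ih => exact IsCP.sum fun i => (ih i).comp (isCP_krausMap _)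
  | charlie C₁ m K hK next ih => exact IsCP.sum fun i => (ih i).comp (isCP_krausMap _)

lemma LOCC.isTP_toMap (P : LOCC B' C' B C) : IsTP P.toMap := by
  induction P with
  | done => exact fun X => rfl
  | @bob B C _ _ _ _ B₁ _ _ m K hK next ih =>
    intro X
    simp only [LOCC.toMap, LinearMap.sum_apply, LinearMap.comp_apply, trace_sum, ih _ _,
      trace_krausMap]
    rw [← trace_sum, ← Finset.sum_mul]
    rw [sum_conjTranspose_mul_kronecker_one hK, Matrix.one_mul]
  | @charlie B C _ _ _ _ C₁ _ _ m K hK next ih =>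
    intro X
    simp only [LOCC.toMap, LinearMap.sum_apply, LinearMap.comp_apply, trace_sum, ih _ _,
      trace_krausMap]
    rw [← trace_sum, ← Finset.sum_mul]
    rw [sum_conjTranspose_mul_one_kronecker hK, Matrix.one_mul]

/-- LOCC channels remain positive when conjugated with the partial transposition. -/
lemma LOCC.isPos_ptMap_toMap_ptMap (P : LOCC B' C' B C) :
    IsPos (ptMap B' C' ∘ₗ P.toMap ∘ₗ ptMap B C) := by
  induction P with
  | done => exact fun X hX => hX
  | @bob B C _ _ _ _ B₁ _ _ m K hK next ih =>
    intro X hX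
    simp only [LOCC.toMap, LinearMap.sum_apply, LinearMap.comp_apply, map_sum]
    refine posSemidef_sum _ fun i _ => ?_
    have := ih i _ (isPos_krausMap ((K i).map star ⊗ₖ (1 : Op C)) X hX)
    rwa [← ptMap_krausMap_left] at this
  | @charlie B C _ _ _ _ C₁ _ _ m K hK next ih =>
    intro X hX
    simp only [LOCC.toMap, LinearMap.sum_apply, LinearMap.comp_apply, map_sum]
    refine posSemidef_sum _ fun i _ => ?_
    have := ih i _ (isPos_krausMap ((1 : Op B) ⊗ₖ K i) X hX)
    rwa [← ptMap_krausMap_right] at this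

end loccprops

section merging

variable {A B C : Type}

/-- The input of a merging protocol: the register `ρR` and the ancilla `μ` are adjoined. -/
def inputMap {Bt Ct : Type} (ρR : Op B) (μ : Op (Bt × Ct)) :
    Op (B × C) →ₗ[ℂ] Op ((B × Bt) × ((C × B) × Ct)) where
  toFun X := Matrix.of fun x y => X (x.1.1, x.2.1.1) (y.1.1, y.2.1.1) * ρR x.2.1.2 y.2.1.2 *
    μ (x.1.2, x.2.2) (y.1.2, y.2.2)
  map_add' X Y := by ext; simp [add_mul]
  map_smul' c X := by ext; simp [mul_assoc]

/-- The output of a merging protocol: everything but Charlie's system and register is discarded. -/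
def outputMap (B D Bt Ct : Type) [Fintype B] [Fintype Bt] [Fintype Ct] :
    Op ((B × Bt) × (D × Ct)) →ₗ[ℂ] Op D where
  toFun X := Matrix.of fun x y => ∑ b : B, ∑ bt : Bt, ∑ ct : Ct,
    X ((b, bt), (x, ct)) ((b, bt), (y, ct))
  map_add' X Y := by ext; simp [Finset.sum_add_distrib]
  map_smul' c X := by ext; simp [Finset.mul_sum]

lemma isCP_inputMap {Bt Ct : Type} [Fintype B] [Fintype C] [Fintype Bt] [Fintype Ct] {ρR : Op B} {μ : Op (Bt × Ct)}
    (hR : ρR.PosSemidef) (hμ : μ.PosSemidef) :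
    IsCP (inputMap (C := C) ρR μ) := fun A _ X hX => by
  have := ((hX.kronecker hR).kronecker hμ).submatrix
    (fun z : A × ((B × Bt) × ((C × B) × Ct)) =>
      (((z.1, z.2.1.1, z.2.2.1.1), z.2.2.1.2), (z.2.1.2, z.2.2.2)))
  exact this

/-- The two transpositions cancel on the input, and the register is Charlie's; only the resource is
left transposed. This is where its PPT property enters. -/
lemma isPos_ptMap_inputMap_ptMap {Bt Ct : Type} [Fintype B] [Fintype C] [Fintype Bt] [Fintype Ct] {ρR : Op B}
    {μ : Op (Bt × Ct)} (hR : ρR.PosSemidef) (hμ : (partialTranspose μ).PosSemidef) :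
    IsPos (ptMap _ _ ∘ₗ inputMap (C := C) ρR μ ∘ₗ ptMap B C) := fun X hX => by
  have := ((hX.kronecker hR).kronecker hμ).submatrix
    (fun z : ((B × Bt) × ((C × B) × Ct)) =>
      (((z.1.1, z.2.1.1), z.2.1.2), (z.1.2, z.2.2)))
  exact this

lemma isTP_inputMap {Bt Ct : Type} [Fintype B] [Fintype C] [Fintype Bt] [Fintype Ct] {ρR : Op B} {μ : Op (Bt × Ct)}
    (hR : ρR.trace = 1) (hμ : μ.trace = 1) : IsTP (inputMap (C := C) ρR μ) := fun X => by
  have h1 : (X.trace * ρR.trace) * μ.trace = X.trace := by rw [hR, hμ]; ring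
  rw [← h1]
  simp only [Matrix.trace, Matrix.diag, Finset.sum_mul_sum, ← Fintype.sum_prod_type']
  refine Fintype.sum_equiv ⟨fun z => (((z.1.1, z.2.1.1), z.2.1.2), (z.1.2, z.2.2)),
    fun z => ((z.1.1.1, z.2.1), ((z.1.1.2, z.1.2), z.2.2)), fun _ => rfl, fun _ => rfl⟩ _ _
    fun z => rfl

lemma isCP_outputMap (B D Bt Ct : Type) [Fintype B] [Fintype D] [Fintype Bt] [Fintype Ct] :
    IsCP (outputMap B D Bt Ct) := fun A _ X hX => by
  have : ampl A (outputMap B D Bt Ct) X = ∑ b : B, ∑ bt : Bt, ∑ ct : Ct,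
      X.submatrix (fun x => (x.1, (b, bt), (x.2, ct))) (fun x => (x.1, (b, bt), (x.2, ct))) := by
    ext x y
    simp [ampl, outputMap, block, Matrix.sum_apply]
  rw [this]
  exact posSemidef_sum _ fun b _ => posSemidef_sum _ fun bt _ => posSemidef_sum _ fun ct _ =>
    hX.submatrix _

lemma isPos_outputMap (B D Bt Ct : Type) [Fintype B] [Fintype D] [Fintype Bt] [Fintype Ct] :
    IsPos (outputMap B D Bt Ct) := fun X hX => by
  have : outputMap B D Bt Ct X = ∑ b : B, ∑ bt : Bt, ∑ ct : Ct,
      X.submatrix (fun x => ((b, bt), (x, ct))) (fun x => ((b, bt), (x, ct))) := by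
    ext x y
    simp [outputMap, Matrix.sum_apply]
  rw [this]
  exact posSemidef_sum _ fun b _ => posSemidef_sum _ fun bt _ => posSemidef_sum _ fun ct _ =>
    hX.submatrix _

/-- All of Bob's systems are traced out, and a trace does not see a transposition. -/
lemma outputMap_comp_ptMap (B D Bt Ct : Type) [Fintype B] [Fintype D] [Fintype Bt] [Fintype Ct] :
    outputMap B D Bt Ct ∘ₗ ptMap _ _ = outputMap B D Bt Ct := rfl

lemma isTP_outputMap (B D Bt Ct : Type) [Fintype B] [Fintype D] [Fintype Bt] [Fintype Ct] :
    IsTP (outputMap B D Bt Ct) := fun X => by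
  simp only [Matrix.trace, Matrix.diag, outputMap, LinearMap.coe_mk, AddHom.coe_mk, of_apply,
    Fintype.sum_prod_type]
  rw [Finset.sum_comm]
  refine Finset.sum_congr rfl fun b _ => ?_
  rw [Finset.sum_comm]

variable [Fintype A] [DecidableEq A] [Fintype B] [DecidableEq B] [Fintype C] [DecidableEq C]

/-- The channel from the systems of Bob and Charlie to Charlie's system and register that is
realized by a merging protocol. -/
def mergeMap (ρR : Op B) (P : PPTAssistedLOCC B (C × B)) : Op (B × C) →ₗ[ℂ] Op (C × B) :=
  outputMap B (C × B) P.Bt P.Ct ∘ₗ P.protocol.toMap ∘ₗ inputMap ρR P.μ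

lemma finalState_eq_ampl (ρ : Op (A × B × C)) (ρR : Op B) (P : PPTAssistedLOCC B (C × B)) :
    finalState ρ ρR P = ampl A (mergeMap ρR P) ρ := by
  ext ⟨a, d⟩ ⟨a', d'⟩
  simp only [finalState, traceBob, PPTAssistedLOCC.apply, traceOut, LOCC.run_eq_ampl, of_apply]
  rfl

variable {ρR : Op B} {P : PPTAssistedLOCC B (C × B)}

lemma isCP_mergeMap (hR : IsDensity ρR) : IsCP (mergeMap ρR P) :=
  (isCP_outputMap _ _ _ _).comp (P.protocol.isCP_toMap.comp (isCP_inputMap hR.1 P.isPPT.1.1))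

lemma isTP_mergeMap (hR : IsDensity ρR) : IsTP (mergeMap ρR P) := fun X =>
  (isTP_outputMap _ _ _ _ _).trans ((P.protocol.isTP_toMap _).trans
    (isTP_inputMap hR.2 P.isPPT.1.2 X))

/-- The constraint that separates merging channels from the ideal transfer of Bob's system.
Transpositions inserted between the three stages cancel in pairs, and the last one is absorbed by
`outputMap`. -/
lemma isPos_mergeMap_ptMap (hR : IsDensity ρR) : IsPos (mergeMap ρR P ∘ₗ ptMap B C) := fun X hX => by
  have h := isPos_outputMap B (C × B) P.Bt P.Ct _ (P.protocol.isPos_ptMap_toMap_ptMap _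
    (isPos_ptMap_inputMap_ptMap (C := C) hR.1 P.isPPT.2 X hX))
  rwa [← LinearMap.comp_apply (outputMap B (C × B) P.Bt P.Ct), ← LinearMap.comp_assoc,
    outputMap_comp_ptMap] at h

end merging
end

/-! ### Local building blocks, and reduction of protocols to tensor factors -/

noncomputable section

section steps

variable {B C S T : Type} [Fintype B] [DecidableEq B] [Fintype C] [DecidableEq C]
  [Fintype S] [DecidableEq S] [Fintype T] [DecidableEq T]

/-- The unitary that relabels the basis vectors along a bijection. -/
def relabel (e : S ≃ T) : Matrix T S ℂ := (1 : Op T).submatrix id e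

lemma relabel_apply (e : S ≃ T) (t : T) (s : S) :
    relabel e t s = if e.symm t = s then 1 else 0 := by
  simp [relabel, Matrix.one_apply, Equiv.symm_apply_eq]

lemma conjTranspose_relabel_mul_relabel (e : S ≃ T) :
    ∑ _x : Unit, (relabel e)ᴴ * relabel e = 1 := by
  ext i j
  simp [Matrix.mul_apply, relabel, Matrix.one_apply, e.injective.eq_iff, eq_comm]

/-- Bob relabels the basis of his system. -/
def LOCC.bobRelabel (e : S ≃ T) : LOCC T C S C :=
  .bobStep (fun _ : Unit => relabel e) (conjTranspose_relabel_mul_relabel e)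

lemma LOCC.toMap_bobRelabel (e : S ≃ T) (X : Op (S × C)) (x y : T × C) :
    (LOCC.bobRelabel e).toMap X x y = X (e.symm x.1, x.2) (e.symm y.1, y.2) := by
  rw [LOCC.bobRelabel, LOCC.toMap_bobStep]
  simp [krausMap_kronecker_one_apply, relabel_apply, apply_ite (starRingEnd ℂ)]

/-- Charlie relabels the basis of his system. -/
def LOCC.charlieRelabel (e : S ≃ T) : LOCC B T B S :=
  .charlieStep (fun _ : Unit => relabel e) (conjTranspose_relabel_mul_relabel e)

lemma LOCC.toMap_charlieRelabel (e : S ≃ T) (X : Op (B × S)) (x y : B × T) :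
    (LOCC.charlieRelabel e).toMap X x y = X (x.1, e.symm x.2) (y.1, e.symm y.2) := by
  rw [LOCC.charlieRelabel, LOCC.toMap_charlieStep]
  simp [krausMap_one_kronecker_apply, relabel_apply, apply_ite (starRingEnd ℂ)]

/-- The channel that discards a system and prepares it in a given state, in Kraus form. -/
lemma exists_kraus_reset {ρ : Op S} (hρ : IsDensity ρ) :
    ∃ K : S × S → Op S, ∑ x, (K x)ᴴ * K x = 1 ∧
      ∀ x y i j, ∑ z, K z x i * star (K z y j) = if i = j then ρ x y else 0 := by
  have h2 := cfcSqrt_mul_self hρ.1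
  set s := CFC.sqrt ρ with hs
  have hsh : sᴴ = s := conjTranspose_cfcSqrt _
  -- The Kraus operators are `√ρ |z.1⟩⟨z.2|`.
  refine ⟨fun z => Matrix.of fun x i => if i = z.2 then s x z.1 else 0, ?_, fun x y i j => ?_⟩
  · ext i j
    have ht : ∑ z, ∑ x, star (s x z) * s x z = 1 := by
      have : (sᴴ * s).trace = 1 := by rw [hsh, h2, hρ.2]
      simpa [Matrix.trace, Matrix.mul_apply] using this
    simp only [Matrix.sum_apply, Matrix.mul_apply, conjTranspose_apply, of_apply,
      Fintype.sum_prod_type, apply_ite star, star_zero, ite_mul, zero_mul, mul_ite, mul_zero]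
    by_cases hij : i = j
    · subst hij
      rw [Matrix.one_apply_eq, ← ht]
      refine Finset.sum_congr rfl fun z _ => ?_
      rw [Finset.sum_eq_single i]
      · simp
      · intro b _ hb
        simp [hb.symm]
      · simp
    · rw [Matrix.one_apply_ne hij]
      refine Finset.sum_eq_zero fun z _ => Finset.sum_eq_zero fun w _ =>
        Finset.sum_eq_zero fun x _ => ?_
      by_cases h : i = w
      · have : j ≠ w := fun h' => hij (h.trans h'.symm)
        simp [this]
      · simp [h]
  · simp only [of_apply, Fintype.sum_prod_type, apply_ite star, star_zero, ite_mul, zero_mul,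
      mul_ite, mul_zero]
    simp only [Finset.sum_ite_eq, Finset.mem_univ, if_true]
    by_cases hij : i = j
    · subst hij
      have : ρ x y = (s * sᴴ) x y := by rw [hsh, h2]
      simp [this, Matrix.mul_apply]
    · simp [hij]

/-- Charlie resets one of his systems to the state `ρ`. -/
lemma exists_locc_reset {ρ : Op S} (hρ : IsDensity ρ) :
    ∃ Q : LOCC B ((C × S) × T) B ((C × S) × T), ∀ X x y,
      Q.toMap X x y = (∑ r, X (x.1, ((x.2.1.1, r), x.2.2)) (y.1, ((y.2.1.1, r), y.2.2))) *
        ρ x.2.1.2 y.2.1.2 := by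
  obtain ⟨K, hK, hK'⟩ := exists_kraus_reset hρ
  refine ⟨.charlieStep _ (sum_conjTranspose_mul_kronecker_one (R := T)
    (sum_conjTranspose_mul_one_kronecker (R := C) hK)), fun X x y => ?_⟩
  obtain ⟨b, ⟨c, r⟩, t⟩ := x
  obtain ⟨b', ⟨c', r'⟩, t'⟩ := y
  rw [LOCC.toMap_charlieStep, LinearMap.sum_apply, Matrix.sum_apply]
  simp only [krausMap_one_kronecker_apply, kroneckerMap_apply, Fintype.sum_prod_type,
    Matrix.one_apply, ite_mul, one_mul, zero_mul, mul_ite, mul_one, mul_zero, apply_ite star,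
    star_zero, Finset.sum_ite_eq, Finset.mem_univ, if_true, Finset.sum_ite_irrel,
    Finset.sum_const_zero]
  rw [← Fintype.sum_prod_type' (f := fun z w => ∑ i, ∑ j,
    K (z, w) r j * X (b, (c, j), t) (b', (c', i), t') * star (K (z, w) r' i)), Finset.sum_comm,
    Finset.sum_mul]
  refine Finset.sum_congr rfl fun i _ => ?_
  rw [Finset.sum_comm]
  calc _ = ∑ j, X (b, (c, j), t) (b', (c', i), t') * ∑ z, K z r j * star (K z r' i) := by
        refine Finset.sum_congr rfl fun j _ => ?_
        rw [Finset.mul_sum]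
        exact Finset.sum_congr rfl fun z _ => by ring
    _ = _ := by simp only [hK']; simp

end steps

section reduction

variable {A A₁ A₂ B B₁ B₂ C C₁ C₂ : Type}
  [Fintype A] [DecidableEq A] [Fintype A₁] [DecidableEq A₁] [Fintype A₂]
  [Fintype B] [DecidableEq B] [Fintype B₁] [DecidableEq B₁] [Fintype B₂] [DecidableEq B₂]
  [Fintype C] [DecidableEq C] [Fintype C₁] [DecidableEq C₁] [Fintype C₂] [DecidableEq C₂]

/-- The tensor product `X ⊗ ω` of bipartite operators as an operator on `B × C`. -/
def tensorAlong (eB : B ≃ B₁ × B₂) (eC : C ≃ C₁ × C₂) (X : Op (B₁ × C₁)) (ω : Op (B₂ × C₂)) :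
    Op (B × C) :=
  Matrix.of fun x y => X ((eB x.1).1, (eC x.2).1) ((eB y.1).1, (eC y.2).1) *
    ω ((eB x.1).2, (eC x.2).2) ((eB y.1).2, (eC y.2).2)

/-- Rearrangement of the factors of a product along decompositions of the factors. -/
def prodRearrange (e₁ : C ≃ C₁ × C₂) (e₂ : B ≃ B₁ × B₂) : C × B ≃ (C₁ × B₁) × (C₂ × B₂) :=
  (e₁.prodCongr e₂).trans (Equiv.prodProdProdComm C₁ C₂ B₁ B₂)

/-- This makes the enlarged resource of `reducedProtocol` admissible: it bundles the state `ω`, the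
complementary register `τ` and the original resource. -/
lemma isPPT_inputMap {Bt Ct : Type} [Fintype Bt] [Fintype Ct] {ω : Op (B × C)} {τ : Op B}
    {μ : Op (Bt × Ct)} (hω : IsPPT ω) (hτ : IsDensity τ) (hμ : IsPPT μ) :
    IsPPT (inputMap τ μ ω) :=
  ⟨⟨(isCP_inputMap hτ.1 hμ.1.1).isPos ω hω.1.1, by
    rw [isTP_inputMap hτ.2 hμ.1.2, hω.1.2]⟩,
    isPos_ptMap_inputMap_ptMap hτ.1 hμ.2 (ptMap B C ω) hω.2⟩

/-- Splitting off a factor of the first component. -/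
def splitAssoc {D D₁ D₂ : Type} (e : D ≃ D₁ × D₂) (T : Type) : D₁ × (D₂ × T) ≃ D × T where
  toFun z := (e.symm (z.1, z.2.1), z.2.2)
  invFun z := ((e z.1).1, ((e z.1).2, z.2))
  left_inv z := by simp
  right_inv z := by simp

/-- The merging protocol for `B₁` and `C₁` that uses the PPT state `ω` on `B₂` and `C₂` as a
resource, runs a given merging protocol for `B` and `C`, and discards `C₂` and its register. -/
def reducedProtocol (eB : B ≃ B₁ × B₂) (eC : C ≃ C₁ × C₂) (P : PPTAssistedLOCC B (C × B))
    {ω : Op (B₂ × C₂)} (hω : IsPPT ω) {τ : Op B₂} (hτ : IsDensity τ)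
    (Q : LOCC (B × P.Bt) ((C × B) × P.Ct) (B × P.Bt) ((C × B) × P.Ct)) :
    PPTAssistedLOCC B₁ (C₁ × B₁) where
  Bt := B₂ × P.Bt
  Ct := (C₂ × B₂) × P.Ct
  μ := inputMap τ P.μ ω
  isPPT := isPPT_inputMap hω hτ P.isPPT
  protocol := (LOCC.bobRelabel (splitAssoc eB P.Bt)).append <|
    (LOCC.charlieRelabel (splitAssoc (prodRearrange eC eB) P.Ct)).append <|
    Q.append <| P.protocol.append <| (LOCC.bobRelabel (splitAssoc eB P.Bt).symm).append
      (LOCC.charlieRelabel (splitAssoc (prodRearrange eC eB) P.Ct).symm)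

lemma inputMap_tensorAlong (eB : B ≃ B₁ × B₂) (eC : C ≃ C₁ × C₂) {ρR : Op B}
    {Bt Ct : Type} [Fintype Bt] [DecidableEq Bt] [Fintype Ct] [DecidableEq Ct] (μ : Op (Bt × Ct))
    (ω : Op (B₂ × C₂)) {ρR₁ : Op B₁} (hR₁ : IsDensity ρR₁) {τ : Op B₂} (hτ : IsDensity τ)
    (Q : LOCC (B × Bt) ((C × B) × Ct) (B × Bt) ((C × B) × Ct))
    (hQ : ∀ X x y, Q.toMap X x y = (∑ r, X (x.1, ((x.2.1.1, r), x.2.2))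
      (y.1, ((y.2.1.1, r), y.2.2))) * ρR x.2.1.2 y.2.1.2) (X : Op (B₁ × C₁)) :
    Q.toMap ((LOCC.charlieRelabel (splitAssoc (prodRearrange eC eB) Ct)).toMap
      ((LOCC.bobRelabel (splitAssoc eB Bt)).toMap (inputMap ρR₁ (inputMap τ μ ω) X))) =
      inputMap ρR μ (tensorAlong eB eC X ω) := by
  ext x y
  rw [hQ]
  simp only [LOCC.toMap_charlieRelabel, LOCC.toMap_bobRelabel]
  have h1 : ∑ r, ρR₁ (eB r).1 (eB r).1 * τ (eB r).2 (eB r).2 = 1 := by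
    rw [eB.sum_comp (fun z => ρR₁ z.1 z.1 * τ z.2 z.2), Fintype.sum_prod_type]
    simp only [← Finset.mul_sum]
    rw [← Finset.sum_mul]
    have a1 : ∑ i, ρR₁ i i = 1 := hR₁.2
    have a2 : ∑ i, τ i i = 1 := hτ.2
    rw [a1, a2, one_mul]
  calc _ = (∑ r, (X ((eB x.1.1).1, (eC x.2.1.1).1) ((eB y.1.1).1, (eC y.2.1.1).1) *
        ω ((eB x.1.1).2, (eC x.2.1.1).2) ((eB y.1.1).2, (eC y.2.1.1).2) *
        μ (x.1.2, x.2.2) (y.1.2, y.2.2)) *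
        (ρR₁ (eB r).1 (eB r).1 * τ (eB r).2 (eB r).2)) * ρR x.2.1.2 y.2.1.2 := by
        congr 1
        refine Finset.sum_congr rfl fun r _ => ?_
        change X ((eB x.1.1).1, (eC x.2.1.1).1) ((eB y.1.1).1, (eC y.2.1.1).1) *
          ρR₁ (eB r).1 (eB r).1 * (ω ((eB x.1.1).2, (eC x.2.1.1).2) ((eB y.1.1).2, (eC y.2.1.1).2) *
          τ (eB r).2 (eB r).2 * μ (x.1.2, x.2.2) (y.1.2, y.2.2)) = _
        ring
    _ = _ := by
        rw [← Finset.mul_sum, h1]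
        simp only [inputMap, LinearMap.coe_mk, AddHom.coe_mk, of_apply, tensorAlong]
        ring

/-- Discarding the surplus factor together with the ancillas is the same as discarding it from the
output of the original protocol; the two sides differ only in the order of summation. -/
lemma outputMap_splitAssoc (eB : B ≃ B₁ × B₂) {D D₁ D₂ : Type} [Fintype D] [DecidableEq D]
    [Fintype D₁] [DecidableEq D₁] [Fintype D₂] [DecidableEq D₂] (eD : D ≃ D₁ × D₂)
    {Bt Ct : Type} [Fintype Bt] [DecidableEq Bt] [Fintype Ct] [DecidableEq Ct]
    (Y : Op ((B × Bt) × (D × Ct))) :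
    outputMap B₁ D₁ (B₂ × Bt) (D₂ × Ct)
      ((LOCC.charlieRelabel (splitAssoc eD Ct).symm).toMap
        ((LOCC.bobRelabel (splitAssoc eB Bt).symm).toMap Y)) =
      traceAlong eD (outputMap B D Bt Ct Y) := by
  ext d d'
  simp only [outputMap, LinearMap.coe_mk, AddHom.coe_mk, of_apply, LOCC.toMap_charlieRelabel,
    LOCC.toMap_bobRelabel, Equiv.symm_symm, traceAlong]
  let F (w : B × Bt) (v : D₂ × Ct) : ℂ :=
    Y (w, splitAssoc eD Ct (d, v)) (w, splitAssoc eD Ct (d', v))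
  have hL : ∑ b, ∑ s, ∑ v, F (splitAssoc eB Bt (b, s)) v = ∑ w, ∑ v, F w v := by
    rw [← (splitAssoc eB Bt).sum_comp (fun w => ∑ v, F w v), Fintype.sum_prod_type]
  have hR : ∑ k, ∑ b, ∑ bt, ∑ ct, F (b, bt) (k, ct) = ∑ w, ∑ v, F w v := by
    rw [Finset.sum_comm (f := F), Fintype.sum_prod_type]
    exact Finset.sum_congr rfl fun k _ =>
      (Fintype.sum_prod_type (fun w => ∑ ct, F w (k, ct))).symm.trans Finset.sum_comm
  exact hL.trans hR.symm

/-- A merging protocol for `B` and `C` induces one for the tensor factors `B₁` and `C₁`, in which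
a PPT state of the complementary factors is used as a resource. -/
lemma exists_mergeMap_eq_traceAlong (eB : B ≃ B₁ × B₂) (eC : C ≃ C₁ × C₂) {ρR : Op B}
    (hR : IsDensity ρR) (P : PPTAssistedLOCC B (C × B)) {ω : Op (B₂ × C₂)} (hω : IsPPT ω)
    {ρR₁ : Op B₁} (hR₁ : IsDensity ρR₁) {τ : Op B₂} (hτ : IsDensity τ) :
    ∃ P' : PPTAssistedLOCC B₁ (C₁ × B₁), ∀ X, mergeMap ρR₁ P' X =
      traceAlong (prodRearrange eC eB) (mergeMap ρR P (tensorAlong eB eC X ω)) := by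
  -- The reset is needed because `ρR` need not be a product over the two factors, whereas the
  -- registers at hand are in the product state `ρR₁ ⊗ τ`.
  obtain ⟨Q, hQ⟩ := exists_locc_reset (B := B × P.Bt) (C := C) (T := P.Ct) hR
  refine ⟨reducedProtocol eB eC P hω hτ Q, fun X => ?_⟩
  rw [show mergeMap ρR P (tensorAlong eB eC X ω) = outputMap B (C × B) P.Bt P.Ct
      (P.protocol.toMap (inputMap ρR P.μ (tensorAlong eB eC X ω))) from rfl,
    ← inputMap_tensorAlong eB eC P.μ ω hR₁ hτ Q hQ X, ← outputMap_splitAssoc eB]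
  change outputMap B₁ (C₁ × B₁) (B₂ × P.Bt) ((C₂ × B₂) × P.Ct)
    (((LOCC.bobRelabel (splitAssoc eB P.Bt)).append <|
      (LOCC.charlieRelabel (splitAssoc (prodRearrange eC eB) P.Ct)).append <|
      Q.append <| P.protocol.append <| (LOCC.bobRelabel (splitAssoc eB P.Bt).symm).append
      (LOCC.charlieRelabel (splitAssoc (prodRearrange eC eB) P.Ct).symm)).toMap
        (inputMap ρR₁ (inputMap τ P.μ ω) X)) = _
  simp only [LOCC.toMap_append, LinearMap.comp_apply]

lemma isDensity_single (b : B) : IsDensity (Matrix.single b b (1 : ℂ)) := by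
  refine ⟨?_, by simp⟩
  have : Matrix.single b b (1 : ℂ) = Matrix.diagonal (Pi.single b 1) := by
    ext i j
    by_cases h : i = j <;> by_cases h' : i = b <;>
      simp [Matrix.single_apply, Matrix.diagonal_apply, h, h', Pi.single_apply] <;> grind
  rw [this]
  refine PosSemidef.diagonal fun i => ?_
  by_cases h : i = b <;> simp [h]

lemma exists_isDensity [Nonempty B] : ∃ ρ : Op B, IsDensity ρ :=
  ⟨_, isDensity_single (Classical.arbitrary B)⟩

lemma IsDensity.nonempty {S : Type} [Fintype S] {ρ : Op S} (h : IsDensity ρ) : Nonempty S := by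
  by_contra hS
  rw [not_nonempty_iff] at hS
  have := h.2
  simp [Matrix.trace] at this

lemma IsCP.isDensity_ampl {S T : Type} [Fintype S] [Fintype T] {Ψ : Op S →ₗ[ℂ] Op T}
    (h : IsCP Ψ) (h' : IsTP Ψ) {ρ : Op (A × S)} (hρ : IsDensity ρ) : IsDensity (ampl A Ψ ρ) := by
  refine ⟨h A ρ hρ.1, ?_⟩
  rw [← hρ.2]
  simp only [Matrix.trace, Fintype.sum_prod_type]
  exact Finset.sum_congr rfl fun a _ => h' (block ρ a a)

lemma isDensity_targetState {ρ : Op (A × B × C)} (hρ : IsDensity ρ) :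
    IsDensity (targetState ρ) := by
  refine ⟨hρ.1.submatrix (fun x : A × (C × B) => (x.1, x.2.2, x.2.1)), ?_⟩
  rw [← hρ.2]
  exact Fintype.sum_equiv ((Equiv.refl A).prodCongr (Equiv.prodComm C B)) _ _ fun x => rfl

lemma fidelity_finalState_le_one {ρ : Op (A × B × C)} (hρ : IsDensity ρ) {ρR : Op B}
    (hR : IsDensity ρR) (P : PPTAssistedLOCC B (C × B)) :
    fidelity (finalState ρ ρR P) (targetState ρ) ≤ 1 := by
  rw [finalState_eq_ampl]
  exact fidelity_le_one ((isCP_mergeMap hR).isDensity_ampl (isTP_mergeMap hR) hρ)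
    (isDensity_targetState hρ)

lemma bddAbove_fidelityPQSM {ρ : Op (A × B × C)} (hρ : IsDensity ρ) :
    BddAbove {f : ℝ | ∃ (P : PPTAssistedLOCC B (C × B)) (ρR : Matrix B B ℂ),
      IsDensity ρR ∧ f = fidelity (finalState ρ ρR P) (targetState ρ)} := by
  refine ⟨1, ?_⟩
  rintro _ ⟨P, ρR, hR, rfl⟩
  exact fidelity_finalState_le_one hρ hR P

lemma nonempty_fidelityPQSM {ρ : Op (A × B × C)} (hρ : IsDensity ρ) :
    {f : ℝ | ∃ (P : PPTAssistedLOCC B (C × B)) (ρR : Matrix B B ℂ),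
      IsDensity ρR ∧ f = fidelity (finalState ρ ρR P) (targetState ρ)}.Nonempty := by
  have : Nonempty B := hρ.nonempty.map fun x => x.2.1
  obtain ⟨ρR, hR⟩ := exists_isDensity (B := B)
  have h1 : (1 : Op (Unit × Unit)).PosSemidef := PosSemidef.one
  have h2 : partialTranspose (1 : Op (Unit × Unit)) = 1 := by
    ext x y
    obtain rfl : x = y := Subsingleton.elim _ _
    simp [partialTranspose]
  exact ⟨_, ⟨Unit, Unit, 1, ⟨⟨h1, by simp⟩, by rwa [h2]⟩, .done⟩, ρR, hR, rfl⟩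

lemma fidelityPQSM_nonneg (ρ : Op (A × B × C)) : 0 ≤ fidelityPQSM ρ :=
  Real.sSup_nonneg (by rintro _ ⟨P, ρR, hR, rfl⟩; exact fidelity_nonneg _ _)

/-- The reduced state of Bob and Charlie. -/
def traceAlice (ρ : Op (A × B × C)) : Op (B × C) := ∑ a, block ρ a a

/-- Tensoring with a state whose reduced state of Bob and Charlie is PPT does not increase the
fidelity of PPT quantum state merging. -/
lemma fidelityPQSM_le_of_tensor (eA : A ≃ A₁ × A₂) (eB : B ≃ B₁ × B₂) (eC : C ≃ C₁ × C₂)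
    {ρ : Op (A × B × C)} {ρ₁ : Op (A₁ × B₁ × C₁)} {ρ₂ : Op (A₂ × B₂ × C₂)}
    (hρ : ∀ x y, ρ x y = ρ₁ ((eA x.1).1, (eB x.2.1).1, (eC x.2.2).1)
        ((eA y.1).1, (eB y.2.1).1, (eC y.2.2).1) *
      ρ₂ ((eA x.1).2, (eB x.2.1).2, (eC x.2.2).2) ((eA y.1).2, (eB y.2.1).2, (eC y.2.2).2))
    (hd : IsDensity ρ) (h₁ : IsDensity ρ₁) (h₂ : IsPPT (traceAlice ρ₂)) :
    fidelityPQSM ρ ≤ fidelityPQSM ρ₁ := by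
  refine csSup_le (nonempty_fidelityPQSM hd) ?_
  rintro _ ⟨P, ρR, hR, rfl⟩
  have n1 : Nonempty B₁ := h₁.nonempty.map fun x => x.2.1
  have n2 : Nonempty B₂ := h₂.1.nonempty.map fun x => x.1
  obtain ⟨ρR₁, hR₁⟩ := exists_isDensity (B := B₁)
  obtain ⟨τ, hτ⟩ := exists_isDensity (B := B₂)
  obtain ⟨P', hP'⟩ := exists_mergeMap_eq_traceAlong eB eC hR P h₂ hR₁ hτ
  refine le_csSup_of_le (bddAbove_fidelityPQSM h₁) ⟨P', ρR₁, hR₁, rfl⟩ ?_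
  have e1 : finalState ρ₁ ρR₁ P' =
      traceAlong (prodRearrange eA (prodRearrange eC eB)) (finalState ρ ρR P) := by
    rw [finalState_eq_ampl, finalState_eq_ampl]
    ext x y
    -- Tracing out Alice's second factor leaves exactly the input of the simulated protocol, with
    -- the reduced state of `ρ₂` as resource.
    have hb : ∑ a₂, block ρ (eA.symm (x.1, a₂)) (eA.symm (y.1, a₂)) =
        tensorAlong eB eC (block ρ₁ x.1 y.1) (traceAlice ρ₂) := by
      ext u v
      simp [block, hρ, tensorAlong, traceAlice, Matrix.sum_apply, Finset.mul_sum]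
    simp only [ampl, of_apply, hP', ← hb, map_sum, traceAlong, Matrix.sum_apply]
    rw [Finset.sum_comm]
    refine Eq.trans ?_ (Fintype.sum_prod_type _).symm
    rfl
  have e2 : targetState ρ₁ =
      traceAlong (prodRearrange eA (prodRearrange eC eB)) (targetState ρ) := by
    ext x y
    have ht : ∑ k : A₂ × (C₂ × B₂), ρ₂ (k.1, k.2.2, k.2.1) (k.1, k.2.2, k.2.1) = 1 := by
      rw [← h₂.1.2]
      simp only [Matrix.trace, Matrix.diag, traceAlice, Matrix.sum_apply, block, of_apply]
      rw [Finset.sum_comm, Fintype.sum_prod_type]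
      refine Finset.sum_congr rfl fun a _ => ?_
      exact Fintype.sum_equiv (Equiv.prodComm C₂ B₂) _ _ fun x => rfl
    have : ∀ k : A₂ × (C₂ × B₂), targetState ρ
        ((prodRearrange eA (prodRearrange eC eB)).symm (x, k))
        ((prodRearrange eA (prodRearrange eC eB)).symm (y, k)) =
        targetState ρ₁ x y * ρ₂ (k.1, k.2.2, k.2.1) (k.1, k.2.2, k.2.1) := by
      intro k
      simp [targetState, hρ, prodRearrange]
    simp only [traceAlong, of_apply, this, ← Finset.mul_sum, ht, mul_one]
  rw [e1, e2, finalState_eq_ampl]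
  exact fidelity_le_fidelity_traceAlong _ (isCP_mergeMap hR A ρ hd.1) (isDensity_targetState hd).1

end reduction
end

/-! ### Choi matrices, compactness and the gap below fidelity one -/

noncomputable section

section choi

variable {S T : Type} [Fintype S] [DecidableEq S] [Fintype T]

/-- The Choi matrix of a linear map of operators. -/
def choi (Ψ : Op S →ₗ[ℂ] Op T) : Op (S × T) :=
  Matrix.of fun x y => Ψ (Matrix.single x.1 y.1 1) x.2 y.2

/-- The linear map of operators with a given Choi matrix. -/
def ofChoi (J : Op (S × T)) : Op S →ₗ[ℂ] Op T where
  toFun X := Matrix.of fun u v => ∑ x, ∑ y, X x y * J (x, u) (y, v)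
  map_add' X Y := by ext; simp [add_mul, Finset.sum_add_distrib]
  map_smul' c X := by ext; simp [mul_assoc, Finset.mul_sum]

lemma ofChoi_apply (J : Op (S × T)) (X : Op S) (u v : T) :
    ofChoi J X u v = ∑ x, ∑ y, X x y * J (x, u) (y, v) := rfl

lemma ofChoi_choi (Ψ : Op S →ₗ[ℂ] Op T) : ofChoi (choi Ψ) = Ψ := by
  refine LinearMap.ext fun X => ?_
  ext u v
  conv_rhs => rw [matrix_eq_sum_single X]
  simp only [map_sum, Matrix.sum_apply, ofChoi_apply, choi, of_apply]
  refine Finset.sum_congr rfl fun x _ => Finset.sum_congr rfl fun y _ => ?_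
  rw [← mul_one (X x y), ← smul_eq_mul (X x y) 1, ← Matrix.smul_single, map_smul]
  simp

lemma choi_ofChoi (J : Op (S × T)) : choi (ofChoi J) = J := by
  ext ⟨x, u⟩ ⟨y, v⟩
  simp [choi, ofChoi_apply, Matrix.single_apply, ite_and]

/-- The Choi matrix is the amplified map applied to the unnormalized maximally entangled state. -/
lemma IsCP.posSemidef_choi {Ψ : Op S →ₗ[ℂ] Op T} (h : IsCP Ψ) : (choi Ψ).PosSemidef := by
  let v : S × S → ℂ := fun z => if z.1 = z.2 then 1 else 0
  have hb (x y : S) : block (vecMulVec v (star v)) x y = Matrix.single x y 1 := by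
    ext i j
    by_cases h1 : x = i <;> by_cases h2 : y = j <;>
      simp [v, block, vecMulVec_apply, h1, h2]
  have := h S _ (posSemidef_vecMulVec_self_star v)
  convert this using 1
  ext x y
  simp only [choi, ampl, of_apply, hb]

lemma isTP_iff_choi {Ψ : Op S →ₗ[ℂ] Op T} :
    IsTP Ψ ↔ ∀ x y, ∑ u, choi Ψ (x, u) (y, u) = if x = y then 1 else 0 := by
  constructor
  · intro h x y
    refine (h (Matrix.single x y 1)).trans ?_
    split_ifs with hxy
    · subst hxy; simp
    · exact Matrix.trace_single_eq_of_ne _ _ _ hxy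
  · intro h X
    rw [← ofChoi_choi Ψ]
    simp only [Matrix.trace, Matrix.diag, ofChoi_apply]
    rw [Finset.sum_comm]
    refine Finset.sum_congr rfl fun x _ => ?_
    rw [Finset.sum_comm]
    simp [← Finset.mul_sum, h]

lemma norm_apply_le_of_posSemidef {J : Op T} (h : J.PosSemidef) (i j : T) :
    ‖J i j‖ ≤ ((J i i).re + (J j j).re) / 2 := by
  classical
  obtain ⟨V, rfl⟩ := CStarAlgebra.nonneg_iff_eq_star_mul_self.mp h.nonneg
  have hd (i : T) : ((star V * V) i i).re = ∑ k, ‖V k i‖ ^ 2 := by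
    simp only [Matrix.mul_apply, Matrix.star_apply, Complex.re_sum]
    refine Finset.sum_congr rfl fun k _ => ?_
    rw [mul_comm, Complex.star_def, Complex.mul_conj, Complex.normSq_eq_norm_sq, Complex.ofReal_re]
  rw [hd, hd, Matrix.mul_apply, ← Finset.sum_add_distrib, Finset.sum_div]
  refine (norm_sum_le _ _).trans (Finset.sum_le_sum fun k _ => ?_)
  rw [Matrix.star_apply, norm_mul, norm_star]
  nlinarith [sq_nonneg (‖V k i‖ - ‖V k j‖)]


lemma isClosed_posSemidef : IsClosed {M : Op T | M.PosSemidef} := by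
  have : {M : Op T | M.PosSemidef} = {M | Mᴴ = M} ∩ ⋂ x : T → ℂ, {M | 0 ≤ star x ⬝ᵥ (M *ᵥ x)} := by
    ext M
    simp [posSemidef_iff_dotProduct_mulVec, IsHermitian]
  rw [this]
  refine (isClosed_eq (by fun_prop) continuous_id).inter (isClosed_iInter fun x => ?_)
  exact isClosed_le continuous_const (by fun_prop)

/-- The Choi matrices of the completely positive trace preserving maps that map `X₀` to a positive
operator. -/
def choiSet (T : Type) [Fintype T] (X₀ : Op S) : Set (Op (S × T)) :=
  {J | J.PosSemidef ∧ (∀ x y, ∑ u, J (x, u) (y, u) = if x = y then 1 else 0) ∧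
    (ofChoi J X₀).PosSemidef}

lemma continuous_ofChoi (X₀ : Op S) : Continuous fun J : Op (S × T) => ofChoi J X₀ := by
  refine continuous_matrix fun u v => ?_
  simp only [ofChoi_apply]
  fun_prop

/-- Each defining condition is closed. Trace preservation bounds the diagonal entries by one, and
positivity extends this bound to all entries. -/
lemma isCompact_choiSet (X₀ : Op S) : IsCompact (choiSet T X₀) := by
  have hc : IsCompact (Set.univ.pi fun _ : S × T => Set.univ.pi fun _ : S × T =>
      Metric.closedBall (0 : ℂ) 1) :=
    isCompact_univ_pi fun _ => isCompact_univ_pi fun _ => isCompact_closedBall _ _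
  refine IsCompact.of_isClosed_subset (X := Op (S × T)) hc ?_ ?_
  · refine isClosed_posSemidef.inter (IsClosed.inter ?_ ?_)
    · have : {J : Op (S × T) | ∀ x y, ∑ u, J (x, u) (y, u) = if x = y then 1 else 0} =
          ⋂ x, ⋂ y, {J | ∑ u, J (x, u) (y, u) = if x = y then 1 else 0} := by
        ext; simp
      refine (congrArg IsClosed this).mpr <| isClosed_iInter fun x => isClosed_iInter fun y => ?_
      exact isClosed_eq (by fun_prop) continuous_const
    · exact isClosed_posSemidef.preimage (continuous_ofChoi X₀)
  · rintro J ⟨hJ, htr, -⟩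
    have hd (i : S × T) : (J i i).re ≤ 1 := by
      have h1 := congrArg Complex.re (htr i.1 i.1)
      rw [if_pos rfl, Complex.re_sum, Complex.one_re] at h1
      rw [← h1]
      exact Finset.single_le_sum (f := fun u => (J (i.1, u) (i.1, u)).re)
        (fun u _ => (Complex.le_def.1 (hJ.diag_nonneg (i := (i.1, u)))).1) (Finset.mem_univ i.2)
    intro i _ j _
    rw [mem_closedBall_zero_iff]
    have := norm_apply_le_of_posSemidef hJ i j
    linarith [hd i, hd j]

end choi

section gap

variable {A B C : Type} [Fintype A] [DecidableEq A] [Fintype B] [DecidableEq B] [Fintype C]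
  [DecidableEq C]

lemma choi_mergeMap_mem {X₀ : Op (B × C)} (hX₀ : X₀.PosSemidef) {ρR : Op B} (hR : IsDensity ρR)
    (P : PPTAssistedLOCC B (C × B)) :
    choi (mergeMap ρR P) ∈ choiSet (C × B) (ptMap B C X₀) := by
  refine ⟨(isCP_mergeMap hR).posSemidef_choi, isTP_iff_choi.1 (isTP_mergeMap hR), ?_⟩
  rw [ofChoi_choi]
  have := isPos_mergeMap_ptMap (P := P) hR X₀ hX₀
  rwa [LinearMap.comp_apply] at this

/-- If no completely positive trace preserving map whose composition with the partial transposition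
is positive on `X₀` merges `ρ` exactly, then merging protocols are bounded away from fidelity one. -/
lemma fidelityPQSM_lt_one {ρ : Op (A × B × C)} (hρ : IsDensity ρ) {X₀ : Op (B × C)}
    (hX₀ : X₀.PosSemidef)
    (h : ∀ Γ : Op (B × C) →ₗ[ℂ] Op (C × B), (choi Γ).PosSemidef → IsTP Γ →
      (Γ (ptMap B C X₀)).PosSemidef → ampl A Γ ρ ≠ targetState ρ) :
    fidelityPQSM ρ < 1 := by
  -- The squared Frobenius distance to the target attains its minimum on the compact set; by
  -- hypothesis that minimum is positive.
  let g (J : Op ((B × C) × (C × B))) : ℝ :=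
    ∑ x, ∑ y, ‖ampl A (ofChoi J) ρ x y - targetState ρ x y‖ ^ 2
  have hg : Continuous g := by
    simp only [g, ampl, ofChoi_apply, of_apply]
    fun_prop
  obtain ⟨_, P₀, ρR₀, hR₀, -⟩ := nonempty_fidelityPQSM hρ
  obtain ⟨J, ⟨hJ, hJtr, hJX⟩, hmin⟩ := (isCompact_choiSet (T := C × B) (ptMap B C X₀)
    ).exists_isMinOn ⟨_, choi_mergeMap_mem hX₀ hR₀ P₀⟩ hg.continuousOn
  have hpos : 0 < g J := by
    have h0 : 0 ≤ g J := by positivity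
    refine lt_of_le_of_ne h0 fun h0 => ?_
    refine h (ofChoi J) (by rwa [choi_ofChoi]) (isTP_iff_choi.2 (by rwa [choi_ofChoi])) hJX ?_
    ext x y
    have h1 := (Finset.sum_eq_zero_iff_of_nonneg (fun _ _ => by positivity)).1 h0.symm x
      (Finset.mem_univ x)
    have h2 := (Finset.sum_eq_zero_iff_of_nonneg (fun _ _ => by positivity)).1 h1 y
      (Finset.mem_univ y)
    exact sub_eq_zero.1 (by simpa using h2)
  set N : ℝ := (Fintype.card (A × (C × B))) ^ 2
  have hne : Nonempty (A × (C × B)) := hρ.nonempty.map fun x => (x.1, x.2.2, x.2.1)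
  have hN : 0 < N := by
    have : 0 < Fintype.card (A × (C × B)) := Fintype.card_pos
    positivity
  -- `N` counts the matrix entries, and `8` is the constant of `norm_sq_sub_le_of_fidelity`.
  have key : fidelityPQSM ρ ≤ 1 - g J / (8 * N) := by
    refine csSup_le (nonempty_fidelityPQSM hρ) ?_
    rintro _ ⟨P, ρR, hR, rfl⟩
    have h1 : g J ≤ g (choi (mergeMap ρR P)) := hmin (choi_mergeMap_mem hX₀ hR P)
    have h2 : g (choi (mergeMap ρR P)) ≤
        N * (8 * (1 - fidelity (finalState ρ ρR P) (targetState ρ))) := by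
      simp only [g, ofChoi_choi, ← finalState_eq_ampl]
      have hf : IsDensity (finalState ρ ρR P) := by
        rw [finalState_eq_ampl]
        exact (isCP_mergeMap hR).isDensity_ampl (isTP_mergeMap hR) hρ
      refine (Finset.sum_le_sum fun x _ => Finset.sum_le_sum fun y _ =>
        norm_sq_sub_le_of_fidelity hf (isDensity_targetState hρ) x y).trans_eq ?_
      simp only [Finset.sum_const, Finset.card_univ, nsmul_eq_mul, N]
      ring
    have h3 : g J / (8 * N) ≤ 1 - fidelity (finalState ρ ρR P) (targetState ρ) := by
      rw [div_le_iff₀ (by positivity)]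
      linarith
    linarith
  have : 0 < g J / (8 * N) := by positivity
  linarith

end gap
end

/-! ### Rank one perturbations of the identity channel -/

noncomputable section

section spectral

variable {S T : Type} [Fintype S] [DecidableEq S] [Fintype T] [DecidableEq T]

/-- A nonzero Hermitian matrix that is orthogonal to a positive definite one has a negative
eigenvalue. -/
lemma exists_neg_eigenvalue {M P : Op S} (hM : M.IsHermitian) (h0 : M ≠ 0) (hP : P.PosDef)
    (htr : (M * P).trace = 0) : ∃ (u : S → ℂ) (t : ℝ), u ≠ 0 ∧ t < 0 ∧ M *ᵥ u = (t : ℂ) • u := by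
  by_contra hcon
  have hnn : ∀ i, 0 ≤ hM.eigenvalues i := by
    intro i
    by_contra hi
    refine hcon ⟨(hM.eigenvectorBasis i).ofLp, hM.eigenvalues i, ?_, not_le.1 hi, ?_⟩
    · intro h
      exact hM.eigenvectorBasis.orthonormal.ne_zero i (by ext j; exact congrFun h j)
    · have := hM.mulVec_eigenvectorBasis i
      rw [this]
      ext j
      simp
  set U : Matrix S S ℂ := hM.eigenvectorUnitary.1
  have hU : U * Uᴴ = 1 := Unitary.mul_star_self_of_mem hM.eigenvectorUnitary.2
  have hQ : (Uᴴ * P * U).PosDef := by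
    refine hP.conjTranspose_mul_mul_same ?_
    have hU' : Uᴴ * U = 1 := Unitary.star_mul_self_of_mem hM.eigenvectorUnitary.2
    intro v w hvw
    have := congrArg (fun z => Uᴴ *ᵥ z) hvw
    simpa [Matrix.mulVec_mulVec, hU'] using this
  have hsp : M = U * diagonal (RCLike.ofReal ∘ hM.eigenvalues) * Uᴴ := by
    have := hM.spectral_theorem
    rwa [Unitary.conjStarAlgAut_apply] at this
  -- In an eigenbasis of `M` the trace weights the eigenvalues by positive numbers, so nonnegative
  -- eigenvalues would all vanish.
  have hsum : ∑ i, (hM.eigenvalues i : ℂ) * (Uᴴ * P * U) i i = 0 := by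
    rw [← htr]
    conv_rhs => rw [hsp, Matrix.mul_assoc, Matrix.mul_assoc, Matrix.trace_mul_comm,
      Matrix.mul_assoc]
    simp [Matrix.trace, Matrix.diagonal_mul]
  have hz : ∀ i, hM.eigenvalues i = 0 := by
    intro i
    have h1 := (Finset.sum_eq_zero_iff_of_nonneg (fun i _ =>
      mul_nonneg (by exact_mod_cast hnn i) hQ.diag_pos.le)).1 hsum i (Finset.mem_univ i)
    rcases mul_eq_zero.1 h1 with h | h
    · exact_mod_cast h
    · exact absurd h hQ.diag_pos.ne'
  exact h0 (hM.eigenvalues_eq_zero_iff.1 (funext hz))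

lemma exists_pos_eigenvalue {M P : Op S} (hM : M.IsHermitian) (h0 : M ≠ 0) (hP : P.PosDef)
    (htr : (M * P).trace = 0) : ∃ (u : S → ℂ) (t : ℝ), u ≠ 0 ∧ 0 < t ∧ M *ᵥ u = (t : ℂ) • u := by
  obtain ⟨u, t, hu, ht, h⟩ := exists_neg_eigenvalue hM.neg (neg_ne_zero.2 h0) hP (by simpa using htr)
  refine ⟨u, -t, hu, neg_pos.2 ht, ?_⟩
  rw [Matrix.neg_mulVec] at h
  rw [← neg_neg (M *ᵥ u), h]
  simp

lemma star_dotProduct_eq_zero_of_eigenvalue_ne {M : Op S} (hM : M.IsHermitian) {u v : S → ℂ}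
    {s t : ℝ} (hu : M *ᵥ u = (s : ℂ) • u) (hv : M *ᵥ v = (t : ℂ) • v) (hst : s ≠ t) :
    star u ⬝ᵥ v = 0 := by
  have h1 : star u ⬝ᵥ (M *ᵥ v) = star (M *ᵥ u) ⬝ᵥ v := by
    rw [Matrix.star_mulVec, hM.eq, Matrix.dotProduct_mulVec]
  rw [hu, hv] at h1
  simp only [dotProduct_smul, star_smul, smul_dotProduct, smul_eq_mul, Complex.star_def,
    Complex.conj_ofReal] at h1
  have h2 : ((t : ℂ) - s) * (star u ⬝ᵥ v) = 0 := by rw [sub_mul, h1, sub_self]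
  rcases mul_eq_zero.1 h2 with h | h
  · exact absurd (by exact_mod_cast (sub_eq_zero.1 h).symm) hst
  · exact h

/-- The product vector `u ⊗ w`. -/
def tensorVec (u : S → ℂ) (w : T → ℂ) : S × T → ℂ := fun z => u z.1 * w z.2

lemma kronecker_mulVec_tensorVec (M : Op S) (N : Op T) (u : S → ℂ) (w : T → ℂ) :
    (M ⊗ₖ N) *ᵥ tensorVec u w = tensorVec (M *ᵥ u) (N *ᵥ w) := by
  ext ⟨i, j⟩
  simp only [mulVec, dotProduct, kroneckerMap_apply, tensorVec, Fintype.sum_prod_type,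
    Finset.sum_mul_sum]
  exact Finset.sum_congr rfl fun _ _ => Finset.sum_congr rfl fun _ _ => by ring

lemma star_tensorVec_dotProduct (u u' : S → ℂ) (w w' : T → ℂ) :
    star (tensorVec u w) ⬝ᵥ tensorVec u' w' = (star u ⬝ᵥ u') * (star w ⬝ᵥ w') := by
  simp only [dotProduct, tensorVec, Fintype.sum_prod_type, Finset.sum_mul_sum, Pi.star_apply,
    star_mul']
  exact Finset.sum_congr rfl fun _ _ => Finset.sum_congr rfl fun _ _ => by ring

/-- A rank one projection on `S × S` cannot compensate the negative part of `H ⊗ Z` if both `H`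
and `Z` have eigenvalues of both signs. -/
lemma not_posSemidef_vecMulVec_add_kronecker {H Z : Op S} (hH : H.IsHermitian)
    {u₁ u₂ w₁ w₂ : S → ℂ} {s₁ s₂ t₁ t₂ : ℝ} (hu₁ : u₁ ≠ 0) (hu₂ : u₂ ≠ 0) (hw₁ : w₁ ≠ 0)
    (hw₂ : w₂ ≠ 0) (hs₁ : 0 < s₁) (hs₂ : s₂ < 0) (ht₁ : t₁ < 0) (ht₂ : 0 < t₂)
    (eu₁ : H *ᵥ u₁ = (s₁ : ℂ) • u₁) (eu₂ : H *ᵥ u₂ = (s₂ : ℂ) • u₂)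
    (ew₁ : Z *ᵥ w₁ = (t₁ : ℂ) • w₁) (ew₂ : Z *ᵥ w₂ = (t₂ : ℂ) • w₂) (v : S × S → ℂ) :
    ¬ (vecMulVec v (star v) + H ⊗ₖ Z).PosSemidef := by
  intro hpsd
  have horth : star u₁ ⬝ᵥ u₂ = 0 :=
    star_dotProduct_eq_zero_of_eigenvalue_ne hH eu₁ eu₂ (by linarith)
  have horth' : star u₂ ⬝ᵥ u₁ = 0 :=
    star_dotProduct_eq_zero_of_eigenvalue_ne hH eu₂ eu₁ (by linarith)
  set a := tensorVec u₁ w₁ with ha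
  set b := tensorVec u₂ w₂ with hb
  have npos {S : Type} [Fintype S] {x : S → ℂ} (hx : x ≠ 0) :
      ∃ r : ℝ, 0 < r ∧ star x ⬝ᵥ x = r := by
    have h1 : 0 ≤ star x ⬝ᵥ x := dotProduct_star_self_nonneg x
    have h2 : star x ⬝ᵥ x ≠ 0 := fun h => hx (dotProduct_star_self_eq_zero.1 h)
    have h3 := lt_of_le_of_ne h1 h2.symm
    exact ⟨(star x ⬝ᵥ x).re, (Complex.lt_def.1 h3).1,
      Complex.ext rfl (by simpa using (Complex.lt_def.1 h3).2.symm)⟩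
  obtain ⟨r₁, hr₁, er₁⟩ := npos hu₁
  obtain ⟨r₂, hr₂, er₂⟩ := npos hu₂
  obtain ⟨q₁, hq₁, eq₁⟩ := npos hw₁
  obtain ⟨q₂, hq₂, eq₂⟩ := npos hw₂
  -- `a` and `b` are orthogonal eigenvectors of `H ⊗ Z` with negative eigenvalues; some nonzero
  -- combination of them is orthogonal to `v`, so the rank one term does not contribute there.
  obtain ⟨α, β, hαβ, hne⟩ : ∃ α β : ℂ, α * (star v ⬝ᵥ a) + β * (star v ⬝ᵥ b) = 0 ∧
      (α ≠ 0 ∨ β ≠ 0) := by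
    by_cases h : star v ⬝ᵥ a = 0 ∧ star v ⬝ᵥ b = 0
    · exact ⟨1, 0, by simp [h.1], Or.inl one_ne_zero⟩
    · refine ⟨star v ⬝ᵥ b, -(star v ⬝ᵥ a), by ring, ?_⟩
      by_contra hc
      push Not at hc
      exact h ⟨neg_eq_zero.1 hc.2, hc.1⟩
  have hq := hpsd.dotProduct_mulVec_nonneg (α • a + β • b)
  have e1 : (vecMulVec v (star v)) *ᵥ (α • a + β • b) = 0 := by
    rw [vecMulVec_mulVec, dotProduct_add, dotProduct_smul, dotProduct_smul, smul_eq_mul,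
      smul_eq_mul, hαβ]
    simp
  have e2 : (H ⊗ₖ Z) *ᵥ (α • a + β • b) = (α * (s₁ * t₁)) • a + (β * (s₂ * t₂)) • b := by
    rw [mulVec_add, mulVec_smul, mulVec_smul, ha, hb, kronecker_mulVec_tensorVec,
      kronecker_mulVec_tensorVec, eu₁, eu₂, ew₁, ew₂]
    ext z
    simp [tensorVec]
    ring
  have e3 : star (α • a + β • b) ⬝ᵥ ((α * (s₁ * t₁)) • a + (β * (s₂ * t₂)) • b) =
      ((‖α‖ ^ 2 * (s₁ * t₁) * (r₁ * q₁) + ‖β‖ ^ 2 * (s₂ * t₂) * (r₂ * q₂) : ℝ) : ℂ) := by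
    have haa : star a ⬝ᵥ a = r₁ * q₁ := by rw [ha, star_tensorVec_dotProduct, er₁, eq₁]
    have hbb : star b ⬝ᵥ b = r₂ * q₂ := by rw [hb, star_tensorVec_dotProduct, er₂, eq₂]
    have hab : star a ⬝ᵥ b = 0 := by rw [ha, hb, star_tensorVec_dotProduct, horth, zero_mul]
    have hba : star b ⬝ᵥ a = 0 := by rw [ha, hb, star_tensorVec_dotProduct, horth', zero_mul]
    have hn (z : ℂ) : star z * z = ((‖z‖ ^ 2 : ℝ) : ℂ) := by
      rw [mul_comm, Complex.star_def, Complex.mul_conj, Complex.normSq_eq_norm_sq]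
    simp only [star_add, star_smul, add_dotProduct, dotProduct_add, smul_dotProduct,
      dotProduct_smul, smul_eq_mul, haa, hbb, hab, hba, mul_zero, add_zero, zero_add]
    push_cast
    have h1 := hn α
    have h2 := hn β
    push_cast at h1 h2
    rw [← h1, ← h2]
    ring
  rw [add_mulVec, e1, e2, zero_add, e3] at hq
  have hq' : 0 ≤ ‖α‖ ^ 2 * (s₁ * t₁) * (r₁ * q₁) + ‖β‖ ^ 2 * (s₂ * t₂) * (r₂ * q₂) := by
    exact_mod_cast hq
  have m1 : s₁ * t₁ * (r₁ * q₁) < 0 :=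
    mul_neg_of_neg_of_pos (mul_neg_of_pos_of_neg hs₁ ht₁) (mul_pos hr₁ hq₁)
  have m2 : s₂ * t₂ * (r₂ * q₂) < 0 :=
    mul_neg_of_neg_of_pos (mul_neg_of_neg_of_pos hs₂ ht₂) (mul_pos hr₂ hq₂)
  have l1 : ‖α‖ ^ 2 * (s₁ * t₁ * (r₁ * q₁)) ≤ 0 := mul_nonpos_of_nonneg_of_nonpos (by positivity) m1.le
  have l2 : ‖β‖ ^ 2 * (s₂ * t₂ * (r₂ * q₂)) ≤ 0 := mul_nonpos_of_nonneg_of_nonpos (by positivity) m2.le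
  rcases hne with h | h
  · have : ‖α‖ ^ 2 * (s₁ * t₁ * (r₁ * q₁)) < 0 :=
      mul_neg_of_pos_of_neg (by have := norm_pos_iff.2 h; positivity) m1
    linarith
  · have : ‖β‖ ^ 2 * (s₂ * t₂ * (r₂ * q₂)) < 0 :=
      mul_neg_of_pos_of_neg (by have := norm_pos_iff.2 h; positivity) m2
    linarith

/-- A completely positive trace preserving map that differs from the identity by a map of rank at
most one is the identity, if it fixes a positive definite matrix. -/
lemma eq_zero_of_eq_add_trace_smul {Φ : Op S →ₗ[ℂ] Op S} (hCP : (choi Φ).PosSemidef)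
    (hTP : IsTP Φ) {G Z P : Op S} (hG : G.IsHermitian) (hG0 : G ≠ 0) (hZ : Z.IsHermitian)
    (h : ∀ X, Φ X = X + (X * G).trace • Z) (hP : P.PosDef) (hΦP : Φ P = P) :
    Z = 0 := by
  by_contra hZ0
  have hGP : (P * G).trace = 0 := by
    have := h P
    rw [hΦP, left_eq_add, smul_eq_zero] at this
    exact this.resolve_right hZ0
  -- Trace preservation gives `Tr(X G) Tr Z = 0` for every `X`; the choice `X = Gᴴ` makes the first
  -- factor nonzero.
  have hZtr : Z.trace = 0 := by
    have h1 := hTP Gᴴ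
    rw [h, trace_add, add_eq_left, trace_smul, smul_eq_mul, mul_eq_zero] at h1
    exact h1.resolve_left fun h' => hG0 (trace_conjTranspose_mul_self_eq_zero_iff.1 h')
  have hGt : Gᵀ.IsHermitian := hG.transpose
  have hGt0 : Gᵀ ≠ 0 := fun h' => hG0 (by simpa using congrArg transpose h')
  have hGtP : (Gᵀ * Pᵀ).trace = 0 := by rw [← transpose_mul, trace_transpose, hGP]
  have hZ1 : (Z * 1).trace = 0 := by rw [mul_one, hZtr]
  obtain ⟨u₁, s₁, hu₁, hs₁, eu₁⟩ := exists_pos_eigenvalue hGt hGt0 hP.transpose hGtP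
  obtain ⟨u₂, s₂, hu₂, hs₂, eu₂⟩ := exists_neg_eigenvalue hGt hGt0 hP.transpose hGtP
  obtain ⟨w₁, t₁, hw₁, ht₁, ew₁⟩ := exists_neg_eigenvalue hZ hZ0 PosDef.one hZ1
  obtain ⟨w₂, t₂, hw₂, ht₂, ew₂⟩ := exists_pos_eigenvalue hZ hZ0 PosDef.one hZ1
  -- The identity contributes the rank one term of the Choi matrix, and the perturbation contributes
  -- `Gᵀ ⊗ Z`.
  refine not_posSemidef_vecMulVec_add_kronecker hGt hu₁ hu₂ hw₁ hw₂ hs₁ hs₂ ht₁ ht₂ eu₁ eu₂ ew₁ ew₂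
    (fun z : S × S => if z.1 = z.2 then (1 : ℂ) else 0) ?_
  convert hCP using 1
  ext ⟨x, u⟩ ⟨y, v⟩
  have : ((Matrix.single x y (1 : ℂ) : Op S) * G).trace = G y x := by
    simp [Matrix.trace, Matrix.mul_apply, Matrix.single_apply, ite_and]
  simp only [choi, of_apply, h, Matrix.add_apply, Matrix.smul_apply, this, vecMulVec_apply,
    Pi.star_apply, kroneckerMap_apply, transpose_apply, smul_eq_mul]
  congr 1
  by_cases h1 : x = u <;> by_cases h2 : y = v <;> simp [h1, h2]

end spectral
end

/-! ### Pauli expansions, and channels that fix the fifteen states -/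

noncomputable section

section pauli

/-- Products of two Pauli matrices. -/
def pauliProd (jk : Fin 4 × Fin 4) : Op (Fin 2 × Fin 2) := pauli jk.1 ⊗ₖ pauli jk.2

lemma conjTranspose_pauli (j : Fin 4) : (pauli j)ᴴ = pauli j := by
  ext a b
  fin_cases j <;> fin_cases a <;> fin_cases b <;> simp [pauli]

lemma pauli_mul_self (j : Fin 4) : pauli j * pauli j = 1 := by
  ext a b
  fin_cases j <;> fin_cases a <;> fin_cases b <;> simp [pauli, Matrix.mul_apply]

lemma pauli_one_mul_three : pauli 1 * pauli 3 = -(pauli 3 * pauli 1) := by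
  ext a b
  fin_cases a <;> fin_cases b <;> simp [pauli, Matrix.mul_apply]

lemma trace_pauli_mul (j k : Fin 4) : (pauli j * pauli k).trace = if j = k then 2 else 0 := by
  fin_cases j <;> fin_cases k <;> simp [pauli, Matrix.trace_fin_two] <;> norm_num

lemma sum_pauli_mul (a b c d : Fin 2) :
    ∑ j, pauli j a b * pauli j c d = if a = d ∧ b = c then 2 else 0 := by
  fin_cases a <;> fin_cases b <;> fin_cases c <;> fin_cases d <;>
    simp [pauli, Fin.sum_univ_four] <;> norm_num

lemma pauliProd_zero : pauliProd (0, 0) = 1 := by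
  simp [pauliProd, pauli]

lemma conjTranspose_pauliProd (jk : Fin 4 × Fin 4) : (pauliProd jk)ᴴ = pauliProd jk := by
  rw [pauliProd, conjTranspose_kronecker, conjTranspose_pauli, conjTranspose_pauli]

lemma trace_pauliProd_mul (i j : Fin 4 × Fin 4) :
    (pauliProd i * pauliProd j).trace = if i = j then 4 else 0 := by
  rw [pauliProd, pauliProd, ← mul_kronecker_mul, trace_kronecker, trace_pauli_mul, trace_pauli_mul]
  by_cases h1 : i.1 = j.1 <;> by_cases h2 : i.2 = j.2 <;> simp [Prod.ext_iff, h1, h2]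
  norm_num

/-- Entrywise this is the completeness relation `sum_pauli_mul` in each tensor factor; the two
factors `2` account for the division by `4`. -/
lemma pauli_expansion (X : Op (Fin 2 × Fin 2)) :
    X = ∑ jk, ((X * pauliProd jk).trace / 4) • pauliProd jk := by
  ext z w
  have h (x y : Fin 2 × Fin 2) : ∑ jk, pauliProd jk y x * pauliProd jk z w =
      if y = w ∧ x = z then 4 else 0 := by
    have : ∀ jk : Fin 4 × Fin 4, pauliProd jk y x * pauliProd jk z w =
        (pauli jk.1 y.1 x.1 * pauli jk.1 z.1 w.1) * (pauli jk.2 y.2 x.2 * pauli jk.2 z.2 w.2) := by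
      intro jk
      simp only [pauliProd, kroneckerMap_apply]
      ring
    simp only [this]
    rw [Fintype.sum_prod_type]
    refine (Finset.sum_mul_sum _ _ (fun j => pauli j y.1 x.1 * pauli j z.1 w.1)
      (fun k => pauli k y.2 x.2 * pauli k z.2 w.2)).symm.trans ?_
    rw [sum_pauli_mul, sum_pauli_mul]
    by_cases h1 : y.1 = w.1 <;> by_cases h2 : y.2 = w.2 <;> by_cases h3 : x.1 = z.1 <;>
      by_cases h4 : x.2 = z.2 <;> simp [Prod.ext_iff, h1, h2, h3, h4]
    norm_num
  have h2 : ∑ jk, (X * pauliProd jk).trace * pauliProd jk z w = 4 * X z w := by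
    simp only [Matrix.trace, Matrix.diag, Matrix.mul_apply, Finset.sum_mul]
    rw [Finset.sum_comm]
    calc _ = ∑ x, ∑ y, X x y * ∑ jk, pauliProd jk y x * pauliProd jk z w := by
          refine Finset.sum_congr rfl fun x _ => ?_
          rw [Finset.sum_comm]
          refine Finset.sum_congr rfl fun y _ => ?_
          rw [Finset.mul_sum]
          exact Finset.sum_congr rfl fun jk _ => by ring
      _ = _ := by
          simp only [h, mul_ite, mul_zero, ite_and]
          simp [mul_comm]
  simp only [Matrix.sum_apply, Matrix.smul_apply, smul_eq_mul]
  have h3 : ∀ jk, (X * pauliProd jk).trace / 4 * pauliProd jk z w =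
      (X * pauliProd jk).trace * pauliProd jk z w / 4 := fun jk => by ring
  simp only [h3]
  rw [← Finset.sum_div, h2]
  field_simp

lemma im_trace_mul_of_isHermitian {S : Type} [Fintype S] {M N : Op S} (hM : M.IsHermitian)
    (hN : N.IsHermitian) : (M * N).trace.im = 0 := by
  have : star (M * N).trace = (M * N).trace := by
    rw [← trace_conjTranspose, conjTranspose_mul, hM.eq, hN.eq, trace_mul_comm]
  exact Complex.conj_eq_iff_im.1 this

end pauli

section fixedPoints

variable {σ : Fin 15 → Op (Fin 2 × Fin 2)}

lemma card_blochIndex : Fintype.card {jk : Fin 4 × Fin 4 // jk ≠ (0, 0)} = 15 := by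
  decide

/-- The span of the states contains `P + c` for every nontrivial product `P` of Pauli matrices. -/
lemma exists_sum_smul_eq_pauliProd (hσ : ∀ i, IsDensity (σ i))
    (hli : LinearIndependent ℝ (fun i => blochVector (σ i))) {jk : Fin 4 × Fin 4}
    (hjk : jk ≠ (0, 0)) : ∃ c : Fin 15 → ℝ,
      pauliProd jk = ∑ i, ((4 * c i : ℝ) : ℂ) • σ i - ((∑ i, c i : ℝ) : ℂ) • 1 := by
  -- Fifteen independent vectors in a fifteen-dimensional space span it, so some combination of the
  -- states has the Bloch vector of a single Pauli product.
  have hspan := hli.span_eq_top_of_card_eq_finrank (by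
    rw [Module.finrank_fintype_fun_eq_card, card_blochIndex, Fintype.card_fin])
  have hmem : (Pi.single ⟨jk, hjk⟩ 1 : {jk : Fin 4 × Fin 4 // jk ≠ (0, 0)} → ℝ) ∈
      Submodule.span ℝ (Set.range fun i => blochVector (σ i)) := hspan ▸ Submodule.mem_top
  obtain ⟨c, hc⟩ := (Submodule.mem_span_range_iff_exists_fun ℝ).1 hmem
  refine ⟨c, ?_⟩
  have htr (l : Fin 4 × Fin 4) (hl : l ≠ (0, 0)) :
      ((∑ i, (c i : ℂ) • σ i) * pauliProd l).trace = if l = jk then 1 else 0 := by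
    have h1 := congrFun hc ⟨l, hl⟩
    rw [Finset.sum_apply] at h1
    rw [Finset.sum_mul, trace_sum]
    have h2 : ∀ i, ((c i : ℂ) • σ i * pauliProd l).trace =
        ((c i * blochVector (σ i) ⟨l, hl⟩ : ℝ) : ℂ) := by
      intro i
      rw [smul_mul, trace_smul, smul_eq_mul, Complex.ofReal_mul]
      congr 1
      refine Complex.ext rfl ?_
      rw [Complex.ofReal_im]
      exact im_trace_mul_of_isHermitian (hσ i).1.1 (conjTranspose_pauliProd l)
    simp only [h2]
    rw [← Complex.ofReal_sum]
    simp only [Pi.smul_apply, smul_eq_mul] at h1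
    rw [h1]
    by_cases h : l = jk <;> simp [h]
  have htr0 : ((∑ i, (c i : ℂ) • σ i) * pauliProd (0, 0)).trace = ((∑ i, c i : ℝ) : ℂ) := by
    rw [pauliProd_zero, mul_one, trace_sum]
    simp [(hσ _).2]
  have hX := pauli_expansion (∑ i, (c i : ℂ) • σ i)
  rw [← Finset.add_sum_erase _ _ (Finset.mem_univ ((0 : Fin 4), (0 : Fin 4))), htr0, pauliProd_zero,
    Finset.sum_congr rfl (g := fun l => if l = jk then ((1 : ℂ) / 4) • pauliProd jk else 0)] at hX
  · rw [Finset.sum_ite_eq', if_pos (Finset.mem_erase.2 ⟨hjk, Finset.mem_univ _⟩)] at hX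
    have h4 : ∑ i, ((4 * c i : ℝ) : ℂ) • σ i = (4 : ℂ) • ∑ i, (c i : ℂ) • σ i := by
      rw [Finset.smul_sum]
      refine Finset.sum_congr rfl fun i _ => ?_
      rw [smul_smul]
      push_cast
      rfl
    rw [h4, hX, smul_add, smul_smul, smul_smul]
    simp only [mul_div_cancel₀ _ (four_ne_zero' ℂ), one_smul]
    abel
  · intro l hl
    rw [htr l (Finset.ne_of_mem_erase hl)]
    by_cases h : l = jk <;> simp [h]

/-- A kernel vector of the sum is annihilated by every state, hence is an eigenvector of every
nontrivial Pauli product. Two anticommuting products that square to one have no common eigenvector.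
-/
lemma posDef_sum_of_linearIndependent (hσ : ∀ i, IsDensity (σ i))
    (hli : LinearIndependent ℝ (fun i => blochVector (σ i))) : (∑ i, σ i).PosDef := by
  have hpsd : (∑ i, σ i).PosSemidef := posSemidef_sum _ fun i _ => (hσ i).1
  refine PosDef.of_dotProduct_mulVec_pos hpsd.1 fun v hv => ?_
  refine lt_of_le_of_ne (hpsd.dotProduct_mulVec_nonneg v) fun h0 => hv ?_
  have hzero : ∀ i, σ i *ᵥ v = 0 := by
    have h1 : ∑ i, star v ⬝ᵥ (σ i *ᵥ v) = 0 := by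
      rw [h0, sum_mulVec, dotProduct_sum]
    intro i
    exact ((hσ i).1.dotProduct_mulVec_zero_iff v).1 ((Finset.sum_eq_zero_iff_of_nonneg
      (fun i _ => (hσ i).1.dotProduct_mulVec_nonneg v)).1 h1 i (Finset.mem_univ i))
  have heig (jk : Fin 4 × Fin 4) (h : jk ≠ (0, 0)) : ∃ t : ℂ, pauliProd jk *ᵥ v = t • v := by
    obtain ⟨c, hc⟩ := exists_sum_smul_eq_pauliProd hσ hli h
    refine ⟨-((∑ i, c i : ℝ) : ℂ), ?_⟩
    rw [hc, sub_mulVec, sum_mulVec]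
    simp only [smul_mulVec, hzero, one_mulVec, smul_zero, Finset.sum_const_zero, zero_sub, neg_smul]
  obtain ⟨s, hs⟩ := heig (1, 0) (by decide)
  obtain ⟨t, ht⟩ := heig (3, 0) (by decide)
  have hsq (jk) : pauliProd jk * pauliProd jk = 1 := by
    rw [pauliProd, ← mul_kronecker_mul, pauli_mul_self, pauli_mul_self, one_kronecker_one]
  have hanti : pauliProd (1, 0) * pauliProd (3, 0) = -(pauliProd (3, 0) * pauliProd (1, 0)) := by
    rw [pauliProd, pauliProd, ← mul_kronecker_mul, ← mul_kronecker_mul, pauli_one_mul_three]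
    ext
    simp
  have e1 : (s * s) • v = v := by
    conv_rhs => rw [← one_mulVec v, ← hsq (1, 0), ← mulVec_mulVec, hs, mulVec_smul, hs, smul_smul]
  have e2 : (t * t) • v = v := by
    conv_rhs => rw [← one_mulVec v, ← hsq (3, 0), ← mulVec_mulVec, ht, mulVec_smul, ht, smul_smul]
  have e3 : (s * t) • v = -((s * t) • v) := by
    have := congrArg (fun M => M *ᵥ v) hanti
    simp only [neg_mulVec, ← mulVec_mulVec, hs, ht, mulVec_smul, smul_smul] at this
    rwa [mul_comm t s] at this
  have e4 : (s * t) • v = 0 := self_eq_neg.1 e3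
  rw [← e1, ← e2, smul_smul, show s * s * (t * t) = (s * t) * (s * t) by ring, ← smul_smul, e4,
    smul_zero]

/-- A completely positive trace preserving map of two-qubit operators that fixes states with
linearly independent generalized Bloch vectors is the identity. -/
lemma eq_id_of_fixes (hσ : ∀ i, IsDensity (σ i))
    (hli : LinearIndependent ℝ (fun i => blochVector (σ i)))
    {Φ : Op (Fin 2 × Fin 2) →ₗ[ℂ] Op (Fin 2 × Fin 2)} (hCP : (choi Φ).PosSemidef) (hTP : IsTP Φ)
    (hfix : ∀ i, Φ (σ i) = σ i) (X : Op (Fin 2 × Fin 2)) : Φ X = X := by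
  -- Modulo the span of the fixed states, every Pauli product is a real multiple of the identity, so
  -- the range of `Φ - id` is spanned by `Z`.
  set Z := Φ 1 - 1 with hZ
  have hd (jk : Fin 4 × Fin 4) : ∃ d : ℝ, Φ (pauliProd jk) = pauliProd jk + (d : ℂ) • Z := by
    by_cases h : jk = (0, 0)
    · exact ⟨1, by rw [h, pauliProd_zero, hZ]; simp⟩
    · obtain ⟨c, hc⟩ := exists_sum_smul_eq_pauliProd hσ hli h
      refine ⟨-∑ i, c i, ?_⟩
      rw [hc, map_sub, map_sum]
      simp only [map_smul, hfix, hZ, smul_sub, Complex.ofReal_neg, neg_smul]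
      abel
  choose d hd using hd
  -- `G` represents, through the trace pairing, the functional that takes the value `d jk` on
  -- `pauliProd jk`; it is Hermitian because these values are real.
  set G : Op (Fin 2 × Fin 2) := ∑ jk, ((d jk / 4 : ℝ) : ℂ) • pauliProd jk with hG
  have h (X : Op (Fin 2 × Fin 2)) : Φ X = X + (X * G).trace • Z := by
    have hX := pauli_expansion X
    have e1 : (X * G).trace = ∑ jk, (X * pauliProd jk).trace / 4 * d jk := by
      rw [hG, Finset.mul_sum, trace_sum]
      refine Finset.sum_congr rfl fun jk _ => ?_
      rw [Matrix.mul_smul, trace_smul, smul_eq_mul]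
      push_cast
      ring
    calc Φ X = ∑ jk, ((X * pauliProd jk).trace / 4) • Φ (pauliProd jk) := by
          conv_lhs => rw [hX, map_sum]
          simp only [map_smul]
      _ = ∑ jk, ((X * pauliProd jk).trace / 4) • pauliProd jk +
          ∑ jk, ((X * pauliProd jk).trace / 4 * d jk) • Z := by
          rw [← Finset.sum_add_distrib]
          exact Finset.sum_congr rfl fun jk _ => by rw [hd, smul_add, smul_smul]
      _ = X + (X * G).trace • Z := by rw [← hX, e1, Finset.sum_smul]
  have hGh : G.IsHermitian := by
    rw [IsHermitian, hG, conjTranspose_sum]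
    refine Finset.sum_congr rfl fun jk _ => ?_
    rw [conjTranspose_smul, conjTranspose_pauliProd, Complex.star_def, Complex.conj_ofReal]
  have hZh : Z.IsHermitian := by
    refine IsHermitian.sub ?_ isHermitian_one
    have h1 : Φ 1 = ∑ x, (choi Φ).submatrix (fun u => (x, u)) (fun u => (x, u)) := by
      rw [← Matrix.sum_single_one, map_sum]
      rfl
    rw [h1]
    exact (posSemidef_sum _ fun x _ => hCP.submatrix _).1
  by_cases hG0 : G = 0
  · rw [h, hG0]; simp
  · have hZ0 : Z = 0 := eq_zero_of_eq_add_trace_smul hCP hTP hGh hG0 hZh h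
      (posDef_sum_of_linearIndependent hσ hli) (by simp only [map_sum, hfix])
    rw [h, hZ0]; simp

/-- The unnormalized maximally entangled state. -/
def bellState : Op (Fin 2 × Fin 2) :=
  let v : Fin 2 × Fin 2 → ℂ := fun z => if z.1 = z.2 then 1 else 0
  vecMulVec v (star v)

lemma posSemidef_bellState : bellState.PosSemidef := posSemidef_vecMulVec_self_star _

/-- No completely positive trace preserving map that remains positive on the maximally entangled
state after the partial transposition transfers all the states from `B` and `C` to Charlie. -/
lemma not_transfers (hσ : ∀ i, IsDensity (σ i))
    (hli : LinearIndependent ℝ (fun i => blochVector (σ i)))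
    {Γ : Op (Fin 2 × Fin 2) →ₗ[ℂ] Op (Fin 2 × Fin 2)} (hCP : (choi Γ).PosSemidef) (hTP : IsTP Γ)
    (hpos : (Γ (ptMap _ _ bellState)).PosSemidef)
    (hfix : ∀ i, Γ (σ i) = (σ i).submatrix Prod.swap Prod.swap) : False := by
  let sw : Op (Fin 2 × Fin 2) →ₗ[ℂ] Op (Fin 2 × Fin 2) :=
    { toFun := fun X => X.submatrix Prod.swap Prod.swap
      map_add' := fun _ _ => rfl
      map_smul' := fun _ _ => rfl }
  have hid := eq_id_of_fixes hσ hli (Φ := sw ∘ₗ Γ)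
    (hCP.submatrix fun z : (Fin 2 × Fin 2) × (Fin 2 × Fin 2) => (z.1, z.2.swap))
    (fun X => (Fintype.sum_equiv (Equiv.prodComm (Fin 2) (Fin 2)) _ _ fun x => rfl).trans (hTP X))
    (fun i => by rw [LinearMap.comp_apply, hfix]; rfl) (ptMap _ _ bellState)
  have hp : (ptMap _ _ bellState).PosSemidef := by
    rw [← hid]
    exact hpos.submatrix _
  -- The off-diagonal entry is one, while both diagonal entries vanish.
  have := norm_apply_le_of_posSemidef hp (0, 1) (1, 0)
  norm_num [ptMap_apply, bellState, vecMulVec_apply] at this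

end fixedPoints
end

/-! ### Monotonicity in the number of copies, the state `rhoSep`, and existence -/

noncomputable section

section states

variable {A B C S T : Type} [Fintype A] [Fintype B] [Fintype C] [Fintype S] [Fintype T]

lemma IsDensity.submatrix_equiv {ρ : Op S} (h : IsDensity ρ) (e : T ≃ S) :
    IsDensity (ρ.submatrix e e) := by
  refine ⟨h.1.submatrix e, ?_⟩
  rw [← h.2]
  exact Fintype.sum_equiv e _ _ fun _ => rfl

lemma IsDensity.kronecker {ρ : Op S} {τ : Op T} (h : IsDensity ρ) (h' : IsDensity τ) :
    IsDensity (ρ ⊗ₖ τ) := by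
  classical
  exact ⟨h.1.kronecker h'.1, by rw [trace_kronecker, h.2, h'.2, one_mul]⟩

lemma convex_isDensity : Convex ℝ {ρ : Op S | IsDensity ρ} := by
  intro ρ hρ τ hτ a b ha hb hab
  refine ⟨(hρ.1.smul ha).add (hτ.1.smul hb), ?_⟩
  rw [trace_add, trace_smul, trace_smul, hρ.2, hτ.2, ← add_smul, hab, one_smul]

lemma convex_isPPT : Convex ℝ {μ : Op (B × C) | IsPPT μ} := by
  intro μ hμ ν hν a b ha hb hab
  exact ⟨convex_isDensity hμ.1 hν.1 ha hb hab, (hμ.2.smul ha).add (hν.2.smul hb)⟩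

/-- For a product state only Bob's factor is transposed, which preserves positivity; convexity does
the rest. -/
lemma IsSeparableState.isPPT {σ : Op (B × C)} (h : IsSeparableState σ) : IsPPT σ := by
  classical
  refine convexHull_min ?_ convex_isPPT h
  rintro _ ⟨β, γ, hβ, hγ, rfl⟩
  exact ⟨hβ.kronecker hγ, hβ.1.transpose.kronecker hγ.1⟩

lemma isDensity_copies {ρ : Op (A × B × C)} (hρ : IsDensity ρ) (n : ℕ) :
    IsDensity (copies n ρ) := by
  induction n with
  | zero =>
    constructor
    · convert posSemidef_vecMulVec_self_star
        (fun _ : (Fin 0 → A) × (Fin 0 → B) × (Fin 0 → C) => (1 : ℂ)) using 1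
      ext x y
      simp [copies, vecMulVec_apply]
    · simp [copies, Matrix.trace]
  | succ n ih =>
    let e : (Fin (n + 1) → A) × (Fin (n + 1) → B) × (Fin (n + 1) → C) ≃
        (A × B × C) × ((Fin n → A) × (Fin n → B) × (Fin n → C)) :=
      ((Fin.consEquiv fun _ => A).symm.prodCongr
        ((Fin.consEquiv fun _ => B).symm.prodCongr (Fin.consEquiv fun _ => C).symm)).trans
      { toFun := fun z => ((z.1.1, z.2.1.1, z.2.2.1), (z.1.2, z.2.1.2, z.2.2.2))
        invFun := fun z => ((z.1.1, z.2.1), (z.1.2.1, z.2.2.1), (z.1.2.2, z.2.2.2))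
        left_inv := fun _ => rfl
        right_inv := fun _ => rfl }
    have : copies (n + 1) ρ = (ρ ⊗ₖ copies n ρ).submatrix e e := by
      ext x y
      simp only [copies, of_apply, Fin.prod_univ_succ]
      rfl
    rw [this]
    exact (hρ.kronecker ih).submatrix_equiv e

variable [DecidableEq A] [DecidableEq B] [DecidableEq C]

/-- One copy is split off, and its reduced state serves as the PPT resource for the others. -/
lemma fidelityPQSM_copies_succ_le {ρ : Op (A × B × C)} (hρ : IsDensity ρ)
    (h : IsPPT (traceAlice ρ)) (n : ℕ) :
    fidelityPQSM (copies (n + 1) ρ) ≤ fidelityPQSM (copies n ρ) := by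
  refine fidelityPQSM_le_of_tensor
    ((Fin.consEquiv fun _ => A).symm.trans (Equiv.prodComm _ _))
    ((Fin.consEquiv fun _ => B).symm.trans (Equiv.prodComm _ _))
    ((Fin.consEquiv fun _ => C).symm.trans (Equiv.prodComm _ _)) (ρ₂ := ρ)
    (fun x y => ?_) (isDensity_copies hρ _) (isDensity_copies hρ n) h
  simp only [copies, of_apply, Fin.prod_univ_succ]
  rw [mul_comm]
  rfl

/-- The relabelling of a one-fold power is obtained from the tensor product bound with a trivial
second factor. -/
lemma fidelityPQSM_copies_one_le {ρ : Op (A × B × C)} (hρ : IsDensity ρ) :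
    fidelityPQSM (copies 1 ρ) ≤ fidelityPQSM ρ := by
  have h1 : traceAlice (1 : Op (Unit × Unit × Unit)) = 1 := by
    ext x y
    obtain rfl : x = y := Subsingleton.elim _ _
    simp [traceAlice, block]
  have h2 : partialTranspose (1 : Op (Unit × Unit)) = 1 := by
    ext x y
    obtain rfl : x = y := Subsingleton.elim _ _
    simp [partialTranspose]
  refine fidelityPQSM_le_of_tensor
    ((Equiv.funUnique (Fin 1) A).trans (Equiv.prodPUnit A).symm)
    ((Equiv.funUnique (Fin 1) B).trans (Equiv.prodPUnit B).symm)
    ((Equiv.funUnique (Fin 1) C).trans (Equiv.prodPUnit C).symm)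
    (ρ₂ := (1 : Op (Unit × Unit × Unit)))
    (fun x y => ?_) (isDensity_copies hρ 1) hρ ?_
  · simp [copies]
  · rw [h1]
    exact ⟨⟨PosSemidef.one, by simp⟩, by rw [h2]; exact PosSemidef.one⟩

lemma exists_hasAsymptoticFidelityPQSM {ρ : Op (A × B × C)} (hρ : IsDensity ρ)
    (h : IsPPT (traceAlice ρ)) : ∃ L, HasAsymptoticFidelityPQSM ρ L :=
  ⟨_, tendsto_atTop_ciInf (antitone_nat_of_succ_le (f := fun n => fidelityPQSM (copies n ρ))
    (fidelityPQSM_copies_succ_le hρ h))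
    ⟨0, by rintro _ ⟨n, rfl⟩; exact fidelityPQSM_nonneg _⟩⟩

lemma not_admitsPerfectAsymptoticPQSM {ρ : Op (A × B × C)} (hρ : IsDensity ρ)
    (h : IsPPT (traceAlice ρ)) (hlt : fidelityPQSM ρ < 1) : ¬ AdmitsPerfectAsymptoticPQSM ρ := by
  intro hadm
  have hanti := antitone_nat_of_succ_le (f := fun n => fidelityPQSM (copies n ρ))
    (fidelityPQSM_copies_succ_le hρ h)
  have := le_of_tendsto hadm ((eventually_ge_atTop 1).mono fun n hn =>
    (hanti hn).trans (fidelityPQSM_copies_one_le hρ))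
  linarith

end states

section classicalQuantum

variable {p : Fin 15 → ℝ} {σ : Fin 15 → Op (Fin 2 × Fin 2)}

lemma block_rhoSep (p : Fin 15 → ℝ) (σ : Fin 15 → Op (Fin 2 × Fin 2)) (i : Fin 15) :
    block (rhoSep p σ) i i = p i • σ i := by
  ext u v
  simp [block, rhoSep, Matrix.sum_apply, Matrix.single_apply]

lemma isDensity_rhoSep (hp : ∀ i, 0 < p i) (hp1 : ∑ i, p i = 1) (hσ : ∀ i, IsDensity (σ i)) :
    IsDensity (rhoSep p σ) :=
  convex_isDensity.sum_mem (fun i _ => (hp i).le) hp1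
    fun i _ => (isDensity_single i).kronecker (hσ i)

lemma isPPT_traceAlice_rhoSep (hp : ∀ i, 0 < p i) (hp1 : ∑ i, p i = 1)
    (hσ : ∀ i, IsPPT (σ i)) : IsPPT (traceAlice (rhoSep p σ)) := by
  simp only [traceAlice, block_rhoSep]
  exact convex_isPPT.sum_mem (fun i _ => (hp i).le) hp1 fun i _ => hσ i

lemma isFullySeparableState_rhoSep (hp : ∀ i, 0 < p i) (hp1 : ∑ i, p i = 1)
    (hσ : ∀ i, IsSeparableState (σ i)) : IsFullySeparableState (rhoSep p σ) := by
  refine (convex_convexHull ℝ _).sum_mem (fun i _ => (hp i).le) hp1 fun i _ => ?_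
  let f : Op (Fin 2 × Fin 2) →ₗ[ℝ] Op (Fin 15 × Fin 2 × Fin 2) :=
    { toFun := fun X => Matrix.single i i (1 : ℂ) ⊗ₖ X
      map_add' := kronecker_add _
      map_smul' := fun c X => kronecker_smul c _ X }
  have : f (σ i) ∈ f '' convexHull ℝ _ := Set.mem_image_of_mem f (hσ i)
  rw [f.image_convexHull] at this
  refine convexHull_mono ?_ this
  rintro _ ⟨_, ⟨β, γ, hβ, hγ, rfl⟩, rfl⟩
  exact ⟨_, β, γ, isDensity_single i, hβ, hγ, rfl⟩

/-- Alice's register is classical, so exact merging can be read off on its diagonal blocks; as the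
weights are nonzero, each `σ i` is transferred separately. -/
lemma fidelityPQSM_rhoSep_lt_one (hp : ∀ i, 0 < p i) (hp1 : ∑ i, p i = 1)
    (hσ : ∀ i, IsDensity (σ i)) (hli : LinearIndependent ℝ (fun i => blochVector (σ i))) :
    fidelityPQSM (rhoSep p σ) < 1 := by
  refine fidelityPQSM_lt_one (isDensity_rhoSep hp hp1 hσ) posSemidef_bellState
    fun Γ hCP hTP hpos heq => not_transfers hσ hli hCP hTP hpos fun i => ?_
  have h1 : p i • Γ (σ i) = p i • (σ i).submatrix Prod.swap Prod.swap := by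
    have h2 : Γ (block (rhoSep p σ) i i) = block (targetState (rhoSep p σ)) i i := by
      rw [← heq, block_ampl]
    have h3 : block (targetState (rhoSep p σ)) i i =
        (block (rhoSep p σ) i i).submatrix Prod.swap Prod.swap := rfl
    rw [h3, block_rhoSep] at h2
    rw [← Complex.coe_smul (p i) (Γ (σ i)), ← map_smul, Complex.coe_smul, h2]
    rfl
  exact smul_right_injective _ (hp i).ne' h1

end classicalQuantum

section existence

/-- The eigenprojections of the Pauli matrices, as states. -/
lemma isDensity_pauli_projection {j : Fin 4} (hj : j ≠ 0) {s : ℝ} (hs : s * s = 1) :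
    IsDensity ((1 / 2 : ℝ) • (1 + s • pauli j)) := by
  -- Since `s` and the Pauli matrix both square to one, half of `1 + s • pauli j` is a projection.
  have hsq : (1 + s • pauli j)ᴴ * (1 + s • pauli j) = (2 : ℝ) • (1 + s • pauli j) := by
    rw [conjTranspose_add, conjTranspose_smul, conjTranspose_one, conjTranspose_pauli, star_trivial,
      Matrix.add_mul, Matrix.one_mul, Matrix.mul_add, Matrix.mul_one, smul_mul_smul_comm,
      pauli_mul_self, hs, one_smul, two_smul]
    abel
  constructor
  · have := (posSemidef_conjTranspose_mul_self (1 + s • pauli j)).smul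
      (show (0 : ℝ) ≤ 1 / 4 by norm_num)
    rw [hsq, smul_smul] at this
    convert this using 2
    norm_num
  · have h0 : (pauli j).trace = 0 := by
      have := trace_pauli_mul j 0
      rw [if_neg hj] at this
      simpa [pauli] using this
    rw [trace_smul, trace_add, trace_smul, h0, trace_one]
    norm_num

lemma isDensity_half_one : IsDensity ((1 / 2 : ℝ) • (1 : Op (Fin 2))) := by
  constructor
  · exact PosSemidef.one.smul (by norm_num : (0 : ℝ) ≤ 1 / 2)
  · rw [trace_smul, trace_one]
    norm_num

/-- If one index is zero this is a product state. Otherwise it is the equal mixture of the products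
of eigenprojections with equal signs, in which the local terms cancel and the correlation term
survives. -/
lemma isSeparableState_one_add_pauliProd {jk : Fin 4 × Fin 4} (h : jk ≠ (0, 0)) :
    IsSeparableState ((1 / 4 : ℝ) • (1 + pauliProd jk)) := by
  obtain ⟨j, k⟩ := jk
  have p0 : pauli 0 = 1 := rfl
  have hone (a b : Fin 2 × Fin 2) : (1 : Op (Fin 2 × Fin 2)) a b =
      (1 : Op (Fin 2)) a.1 b.1 * (1 : Op (Fin 2)) a.2 b.2 := by
    rw [← one_kronecker_one]; rfl
  by_cases hj : j = 0
  · have hk : k ≠ 0 := fun hk => h (by rw [hj, hk])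
    refine subset_convexHull ℝ _ ⟨_, _, isDensity_half_one,
      isDensity_pauli_projection hk (one_mul (1 : ℝ)), ?_⟩
    rw [pauliProd, hj, p0]
    ext a b
    simp [hone]
    ring
  · by_cases hk : k = 0
    · refine subset_convexHull ℝ _ ⟨_, _, isDensity_pauli_projection hj (one_mul (1 : ℝ)),
        isDensity_half_one, ?_⟩
      rw [pauliProd, hk, p0]
      ext a b
      simp [hone]
      ring
    · have e : (1 / 4 : ℝ) • (1 + pauliProd (j, k)) =
          (1 / 2 : ℝ) • (((1 / 2 : ℝ) • (1 + (1 : ℝ) • pauli j)) ⊗ₖ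
            ((1 / 2 : ℝ) • (1 + (1 : ℝ) • pauli k))) +
          (1 / 2 : ℝ) • (((1 / 2 : ℝ) • (1 + (-1 : ℝ) • pauli j)) ⊗ₖ
            ((1 / 2 : ℝ) • (1 + (-1 : ℝ) • pauli k))) := by
        rw [pauliProd]
        ext a b
        simp [hone]
        ring
      rw [e]
      refine convex_convexHull ℝ _ (subset_convexHull ℝ _ ?_) (subset_convexHull ℝ _ ?_)
        (by norm_num) (by norm_num) (by norm_num)
      · exact ⟨_, _, isDensity_pauli_projection hj (by norm_num),
          isDensity_pauli_projection hk (by norm_num), rfl⟩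
      · exact ⟨_, _, isDensity_pauli_projection hj (by norm_num),
          isDensity_pauli_projection hk (by norm_num), rfl⟩

lemma blochVector_one_add_pauliProd (jk : {jk : Fin 4 × Fin 4 // jk ≠ (0, 0)}) :
    blochVector ((1 / 4 : ℝ) • (1 + pauliProd jk)) = Pi.single jk 1 := by
  ext l
  have h1 : (pauliProd l.1).trace = 0 := by
    have := trace_pauliProd_mul l.1 (0, 0)
    rwa [pauliProd_zero, mul_one, if_neg l.2] at this
  change (((1 / 4 : ℝ) • (1 + pauliProd jk)) * pauliProd l.1).trace.re = _
  rw [smul_mul, Matrix.add_mul, Matrix.one_mul, trace_smul, trace_add, h1, trace_pauliProd_mul,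
    Complex.smul_re]
  by_cases h : jk = l
  · subst h; simp
  · rw [if_neg fun h' => h (Subtype.ext h'), Pi.single_eq_of_ne (Ne.symm h)]
    simp

lemma exists_isSeparableState_linearIndependent_blochVector :
    ∃ σ : Fin 15 → Op (Fin 2 × Fin 2),
      (∀ i, IsSeparableState (σ i)) ∧ LinearIndependent ℝ (fun i => blochVector (σ i)) := by
  let e : Fin 15 ≃ {jk : Fin 4 × Fin 4 // jk ≠ (0, 0)} :=
    (Fintype.equivFinOfCardEq card_blochIndex).symm
  refine ⟨fun i => (1 / 4 : ℝ) • (1 + pauliProd (e i)),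
    fun i => isSeparableState_one_add_pauliProd (e i).2, ?_⟩
  simp only [blochVector_one_add_pauliProd]
  have := (Pi.basisFun ℝ {jk : Fin 4 × Fin 4 // jk ≠ (0, 0)}).linearIndependent.comp e e.injective
  convert this using 1
  ext i
  simp

end existence
end

theorem mainTheorem2 :
    (∃ σ : Fin 15 → Matrix (Fin 2 × Fin 2) (Fin 2 × Fin 2) ℂ,
      (∀ i, IsSeparableState (σ i)) ∧ LinearIndependent ℝ (fun i => blochVector (σ i))) ∧
    ∀ (p : Fin 15 → ℝ) (σ : Fin 15 → Matrix (Fin 2 × Fin 2) (Fin 2 × Fin 2) ℂ),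
      (∀ i, 0 < p i) → ∑ i, p i = 1 → (∀ i, IsSeparableState (σ i)) →
      LinearIndependent ℝ (fun i => blochVector (σ i)) →
      IsFullySeparableState (rhoSep p σ) ∧
      (∃ L : ℝ, HasAsymptoticFidelityPQSM (rhoSep p σ) L) ∧
      ¬ AdmitsPerfectAsymptoticPQSM (rhoSep p σ) := by
  refine ⟨exists_isSeparableState_linearIndependent_blochVector, fun p σ hp hp1 hσ hli => ?_⟩
  have hppt := fun i => (hσ i).isPPT
  have hρ := isDensity_rhoSep hp hp1 fun i => (hppt i).1
  have hmarg := isPPT_traceAlice_rhoSep hp hp1 hppt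
  exact ⟨isFullySeparableState_rhoSep hp hp1 hσ, exists_hasAsymptoticFidelityPQSM hρ hmarg,
    not_admitsPerfectAsymptoticPQSM hρ hmarg
      (fidelityPQSM_rhoSep_lt_one hp hp1 (fun i => (hppt i).1) hli)⟩
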